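/- For a real number $x$ let $\|x\|$ denote its distance to the closest integer. For a sequence $x=(x_n)_{n\in\mathbb N}$ in $[0,1)$, $0<\alpha\le 1$, $s>0$ and $N\in\mathbb N$ put $$R_\alpha(s,N)=\frac{1}{N^{2-\alpha}}\#\left\{1\le i\ne j\le N:\ \|x_i-x_j\|\le \frac{s}{N^\alpha}\right\},\qquad R(s,N)=R_1(s,N).$$ The sequence has $\alpha$-Poissonian pair correlations ($\alpha$-PPC) if $\lim_{N\to\infty}R_\alpha(s,N)=2s$ for every $s>0$; for $\alpha=1$ one says that it has Poissonian pair correlations (PPC). A sequential jittered sampling sequence $(X_n)_{n\in\mathbb N}$ is constructed as follows, where all random points $Z_m$ are uniformly distributed on $[0,1)$, all random permutations are uniformly distributed on the respective symmetric group, and all of these random objects are independent. The first two points are $X_k=\frac{\pi_0(k)-1+Z_k}{2}$, $k=1,2$, with a random permutation $\pi_0$ of $\{1,2\}$. Once $N=2^n$ points $X_1,\dots,X_N$ ($n\ge 1$) are constructed, let $c_1<\dots<c_N$ be the left end points of those of the $2N$ intervals $\left[\frac{j}{2N},\frac{j+1}{2N}\right)$, $0\le j<2N$, which contain none of the points $X_1,\dots,X_N$,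 and put $$X_{N+k}=c_{\pi_n(k)}+\frac{Z_{N+k}}{2N},\qquad 1\le k\le N,$$ with a random permutation $\pi_n$ of $\{1,\dots,N\}$. Theorem. Let $X=(X_n)_{n\in\mathbb N}$ be a sequential jittered sampling sequence. (i) Almost surely, $X$ does not have PPC. Moreover, for $s=\frac12$ and $N=2^n$ one has $\lim_{n\to\infty}\mathbb E\left[R\left(\tfrac12,2^n\right)\right]=\frac14$ (whereas $2s=1$). (ii) Almost surely, $X$ has $\alpha$-PPC for every $\alpha\in(0,1)$. -/

import Mathlib

open MeasureTheory ProbabilityTheory Filter Topology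

namespace SeqJitter

/-- The distance of a real number to its closest integer. -/
noncomputable def distInt (x : ℝ) : ℝ := |x - (round x : ℝ)|

open Classical in
/-- The pair correlation statistic
`R_α(s, N) = N ^ (-(2 - α)) * #{1 ≤ i ≠ j ≤ N : ‖x_i - x_j‖ ≤ s / N ^ α}` (ordered pairs).
Sequences are indexed from `0`: the first `N` points of `x` are `x 0, …, x (N - 1)`. -/
noncomputable def pairCorr (α s : ℝ) (x : ℕ → ℝ) (N : ℕ) : ℝ :=
  1 / (N : ℝ) ^ (2 - α) *
    (((Finset.range N ×ˢ Finset.range N).filter fun p =>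
      p.1 ≠ p.2 ∧ distInt (x p.1 - x p.2) ≤ s / (N : ℝ) ^ α).card : ℝ)

/-- `α`-Poissonian pair correlations; `α = 1` is the property PPC. -/
def HasPPC (α : ℝ) (x : ℕ → ℝ) : Prop :=
  ∀ s : ℝ, 0 < s → Tendsto (fun N : ℕ => pairCorr α s x N) atTop (𝓝 (2 * s))

/-- The `j`-th of the `2 * N` half-open intervals of length `1 / (2 * N)` (counted from `0`)
contains none of the first `N` points of `x`. -/
def IsEmptySlot (x : ℕ → ℝ) (N j : ℕ) : Prop :=
  j < 2 * N ∧ ∀ i < N, x i ∉ Set.Ico ((j : ℝ) / (2 * N)) (((j : ℝ) + 1) / (2 * N))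

/-- The left end point of the `k`-th empty slot (in increasing order, counted from `0`). -/
noncomputable def emptySlotLeft (x : ℕ → ℝ) (N k : ℕ) : ℝ :=
  (Nat.nth (IsEmptySlot x N) k : ℝ) / (2 * N)

/-- The number of points created at each stage of the construction: two at the beginning, and
then, whenever `2 ^ (n + 1)` points are present, another `2 ^ (n + 1)` of them. -/
def stageSize : ℕ → ℕ
  | 0 => 2
  | n + 1 => 2 ^ (n + 1)

/-- Permutations carry the discrete `σ`-algebra. -/
instance instMeasurableSpacePerm (N : ℕ) : MeasurableSpace (Equiv.Perm (Fin N)) := ⊤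

/-- `X` is the sequence built from the random permutations `perm` (one for each stage) and the
random points `Z` (one for each index): all of them are independent, the permutations are
uniformly distributed on the symmetric groups and the points are uniformly distributed on
`[0, 1)`. -/
structure IsConstruction {Ω : Type*} [MeasurableSpace Ω] (μ : Measure Ω) (X : ℕ → Ω → ℝ)
    (perm : (t : ℕ) → Ω → Equiv.Perm (Fin (stageSize t))) (Z : ℕ → Ω → ℝ) : Prop where
  measurable_perm : ∀ t, Measurable (perm t)
  measurable_Z : ∀ m, Measurable (Z m)
  perm_uniform : ∀ t, ∀ σ : Equiv.Perm (Fin (stageSize t)),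
    μ {ω | perm t ω = σ} = ((stageSize t).factorial : ENNReal)⁻¹
  Z_uniform : ∀ m, μ.map (Z m) = (volume : Measure ℝ).restrict (Set.Ico 0 1)
  indep_perm : iIndepFun perm μ
  indep_Z : iIndepFun Z μ
  indep_perm_Z : IndepFun (fun ω t => perm t ω) (fun ω m => Z m ω) μ
  /-- The first two points form a jittered sample. -/
  init : ∀ ω, ∀ k : Fin 2, X k ω = (((perm 0 ω k : Fin 2) : ℕ) + Z k ω) / 2
  /-- With `N = 2 ^ (n + 1)` points constructed, the `k`-th new one is placed uniformly into
  the empty slot whose rank is given by the random permutation. -/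
  step : ∀ ω, ∀ n : ℕ, ∀ k : Fin (2 ^ (n + 1)),
    X (2 ^ (n + 1) + k) ω =
      emptySlotLeft (fun i => X i ω) (2 ^ (n + 1))
          ((perm (n + 1) ω k : Fin (2 ^ (n + 1))) : ℕ) +
        Z (2 ^ (n + 1) + k) ω / (2 * 2 ^ (n + 1))

/-- `X` is a sequential jittered sampling sequence on the probability space `(Ω, μ)`. -/
def IsSequentialJitteredSampling {Ω : Type*} [MeasurableSpace Ω] (μ : Measure Ω)
    (X : ℕ → Ω → ℝ) : Prop :=
  ∃ (perm : (t : ℕ) → Ω → Equiv.Perm (Fin (stageSize t))) (Z : ℕ → Ω → ℝ),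
    IsConstruction μ X perm Z

end SeqJitter

/-! When `M = 2 ^ (n + 1)` points are present, each cell of length `1 / M` contains exactly one of
them (`Built.jittered`). The empty half-cell of rank `a` is the empty half of cell `a`, so the next
stage doubles the cells in the order of a uniform permutation. Everything rests on this description.

Failure of PPC is deterministic once all `Z m` lie in `[0, 1)`. For `s ≤ 1` only points in adjacent
cells can be close, and `R(s, M)` is twice the proportion of cells `a` with `u a - u (a + 1) ≥ 1 -
s`, where `u` denotes relative positions (`Jittered.pairCorr_one`). PPC at `s = 1` would make almost
all these increments nonnegative, and PPC at `s = 1 / 2` would make about half of them at least `1 /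
2`; but they sum to zero around the circle (`half_card_drops_le`). For the expectation, the relative
positions in two distinct cells are independent and uniform, because halving a cell preserves the
uniform law on the square (`measurePreserving_cellPos`); an increment is at least `1 / 2` with
probability `1 / 8`, hence the value `2 / 8`.

For `α < 1` the relevant distance spans about `N ^ (1 - α)` cells, so only the number of points in
long windows of cells matters. Between two powers of two these numbers fluctuate only through the
set of doubled cells, that is, the first `k` values of a uniform permutation. Occupations of
distinct cells are nonpositively correlated (`sum_dev_mul_dev_nonpos`), so windows of `B` cells have
variance at most `B`. With `B` a power of `n`, the fluctuation is summable over the stages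
(`ae_tendsto_stageFluct`), uniformly in `k`, and it controls all longer windows
(`mul_sum_abs_winSum_le`). The resulting null set depends on neither `α` nor `s`. -/

namespace SeqJitter

/-! ### Relative positions inside the dyadic cells. -/

/-- The index of the first point created at stage `t`. -/
def stageStart : ℕ → ℕ
  | 0 => 0
  | n + 1 => 2 ^ (n + 1)

/-- The relative position of the point that stage `t` puts into the slot of rank `a`. -/
noncomputable def slotPos (p : (t : ℕ) → Equiv.Perm (Fin (stageSize t))) (z : ℕ → ℝ)
    (t a : ℕ) : ℝ :=
  if h : a < stageSize t then z (stageStart t + ((p t).symm ⟨a, h⟩ : ℕ)) else 0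

/-- A cell is halved: `u` is the relative position of its old point, `w` that of the new one in
the empty half; the result lists the relative positions in the left and the right half. -/
noncomputable def halve (q : ℝ × ℝ) : ℝ × ℝ :=
  if q.1 < 1 / 2 then (2 * q.1, q.2) else (q.2, 2 * q.1 - 1)

/-- The relative position of the point in the `a`-th cell when `2 ^ (n + 1)` points are
present. -/
noncomputable def cellPos (p : (t : ℕ) → Equiv.Perm (Fin (stageSize t))) (z : ℕ → ℝ) :
    ℕ → ℕ → ℝ
  | 0, a => slotPos p z 0 a
  | n + 1, a =>
    if a % 2 = 0 then (halve (cellPos p z n (a / 2), slotPos p z (n + 1) (a / 2))).1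
    else (halve (cellPos p z n (a / 2), slotPos p z (n + 1) (a / 2))).2

section Outcome

variable {p : (t : ℕ) → Equiv.Perm (Fin (stageSize t))} {z : ℕ → ℝ} {x : ℕ → ℝ}

lemma slotPos_mem (hz : ∀ m, z m ∈ Set.Ico (0 : ℝ) 1) (t a : ℕ) :
    slotPos p z t a ∈ Set.Ico (0 : ℝ) 1 := by
  unfold slotPos
  split_ifs
  · exact hz _
  -- The default value `0` lies in `[0, 1)`, so no bound on `a` is needed here or later.
  · simp

lemma halve_mem {u w : ℝ} (hu : u ∈ Set.Ico (0 : ℝ) 1) (hw : w ∈ Set.Ico (0 : ℝ) 1) :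
    (halve (u, w)).1 ∈ Set.Ico (0 : ℝ) 1 ∧ (halve (u, w)).2 ∈ Set.Ico (0 : ℝ) 1 := by
  unfold halve
  obtain ⟨h1, h2⟩ := hu
  obtain ⟨h3, h4⟩ := hw
  simp only
  split_ifs with h
  · exact ⟨⟨by linarith, by linarith⟩, h3, h4⟩
  · exact ⟨⟨h3, h4⟩, by linarith, by linarith⟩

lemma cellPos_mem (hz : ∀ m, z m ∈ Set.Ico (0 : ℝ) 1) (n a : ℕ) :
    cellPos p z n a ∈ Set.Ico (0 : ℝ) 1 := by
  induction n generalizing a with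
  | zero => exact slotPos_mem hz 0 a
  | succ n ih =>
    unfold cellPos
    have := halve_mem (ih (a / 2)) (slotPos_mem (p := p) hz (n + 1) (a / 2))
    split_ifs
    · exact this.1
    · exact this.2

/-- The rank of the slot that receives the `k`-th point of stage `t`. -/
def rankAt (p : (t : ℕ) → Equiv.Perm (Fin (stageSize t))) (t k : ℕ) : ℕ :=
  if h : k < stageSize t then (p t ⟨k, h⟩ : ℕ) else 0

lemma rankAt_lt {t k : ℕ} (hk : k < stageSize t) : rankAt p t k < stageSize t := by
  rw [rankAt, dif_pos hk]
  exact (p t ⟨k, hk⟩).2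

lemma rankAt_inj {t k l : ℕ} (hk : k < stageSize t) (hl : l < stageSize t)
    (h : rankAt p t k = rankAt p t l) : k = l := by
  rw [rankAt, rankAt, dif_pos hk, dif_pos hl] at h
  exact congrArg Fin.val ((p t).injective (Fin.ext h))

lemma slotPos_rankAt {t k : ℕ} (hk : k < stageSize t) :
    slotPos p z t (rankAt p t k) = z (stageStart t + k) := by
  rw [slotPos, dif_pos (rankAt_lt hk)]
  congr 2
  have : (⟨rankAt p t k, rankAt_lt hk⟩ : Fin (stageSize t)) = p t ⟨k, hk⟩ := by
    ext
    simp [rankAt, hk]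
  rw [this, Equiv.symm_apply_apply]

/-- A slot is half a cell: `2 * a` and `2 * a + 1` are the left and right halves of cell `a`. -/
lemma mem_slot_iff {M a j : ℕ} {u : ℝ} (hM : 0 < M) (hu : u ∈ Set.Ico (0 : ℝ) 1) :
    ((a : ℝ) + u) / M ∈ Set.Ico ((j : ℝ) / (2 * M)) (((j : ℝ) + 1) / (2 * M)) ↔
      j = if u < 1 / 2 then 2 * a else 2 * a + 1 := by
  have hM' : (0 : ℝ) < M := by exact_mod_cast hM
  obtain ⟨h1, h2⟩ := hu
  have e1 : (j : ℝ) / (2 * M) ≤ (a + u) / M ↔ (j : ℝ) ≤ 2 * a + 2 * u := by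
    rw [div_le_div_iff₀ (by positivity) hM']
    constructor <;> intro h <;> nlinarith
  have e2 : (a + u) / M < ((j : ℝ) + 1) / (2 * M) ↔ 2 * a + 2 * u < (j : ℝ) + 1 := by
    rw [div_lt_div_iff₀ hM' (by positivity)]
    constructor <;> intro h <;> nlinarith
  rw [Set.mem_Ico, e1, e2]
  constructor
  · rintro ⟨h3, h4⟩
    split_ifs with h
    · have h5 : (j : ℝ) < ((2 * a + 1 : ℕ) : ℝ) := by push_cast; linarith
      have h6 : ((2 * a : ℕ) : ℝ) < ((j + 1 : ℕ) : ℝ) := by push_cast; linarith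
      have := Nat.cast_lt.mp h5
      have := Nat.cast_lt.mp h6
      omega
    · have h5 : (j : ℝ) < ((2 * a + 2 : ℕ) : ℝ) := by push_cast; linarith
      have h6 : ((2 * a + 1 : ℕ) : ℝ) < ((j + 1 : ℕ) : ℝ) := by push_cast; linarith
      have := Nat.cast_lt.mp h5
      have := Nat.cast_lt.mp h6
      omega
  · intro h
    split_ifs at h with h' <;> subst h <;> push_cast <;> constructor <;> linarith

/-! ### One point per cell, and the position of the empty slots. -/

/-- The first `M` points lie one in each cell, at the relative positions `u`, in an order given
by `ρ`. -/
structure Jittered (x : ℕ → ℝ) (M : ℕ) (u : ℕ → ℝ) (ρ : ℕ → ℕ) : Prop where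
  lt : ∀ i < M, ρ i < M
  inj : ∀ i < M, ∀ j < M, ρ i = ρ j → i = j
  eq : ∀ i < M, x i = ((ρ i : ℝ) + u (ρ i)) / M

lemma Jittered.surj {M : ℕ} {u : ℕ → ℝ} {ρ : ℕ → ℕ} (h : Jittered x M u ρ) {a : ℕ}
    (ha : a < M) : ∃ i < M, ρ i = a := by
  have : Set.SurjOn ρ (Finset.range M) (Finset.range M) :=
    Finset.surjOn_of_injOn_of_card_le ρ (fun i hi => by simpa using h.lt i (by simpa using hi))
      (fun i hi j hj e => h.inj i (by simpa using hi) j (by simpa using hj) e) le_rfl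
  obtain ⟨i, hi, e⟩ := this (by simpa using ha : a ∈ (Finset.range M : Set ℕ))
  exact ⟨i, by simpa using hi, e⟩

lemma Jittered.isEmptySlot_iff {M : ℕ} {u : ℕ → ℝ} {ρ : ℕ → ℕ} (h : Jittered x M u ρ)
    (hu : ∀ a, u a ∈ Set.Ico (0 : ℝ) 1) (j : ℕ) :
    IsEmptySlot x M j ↔ j < 2 * M ∧ j = if u (j / 2) < 1 / 2 then 2 * (j / 2) + 1
      else 2 * (j / 2) := by
  unfold IsEmptySlot
  refine and_congr_right fun hj => ?_
  have hM : 0 < M := by omega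
  constructor
  · intro H
    obtain ⟨i, hi, e⟩ := h.surj (a := j / 2) (by omega)
    have := H i hi
    rw [h.eq i hi, mem_slot_iff hM (hu _), e] at this
    split_ifs at this ⊢ <;> omega
  · intro H i hi
    rw [h.eq i hi, mem_slot_iff hM (hu _)]
    intro H'
    have e : ρ i = j / 2 := by split_ifs at H' <;> omega
    rw [e] at H'
    split_ifs at H' H <;> omega

-- Each cell has exactly one empty half, so the first `2 * b` slots contain `b` empty ones. Hence
-- the rank of an empty slot is the number of its cell, and the sorting hidden in `Nat.nth`
-- disappears.
open Classical in
lemma Jittered.emptySlotLeft_eq {M : ℕ} {u : ℕ → ℝ} {ρ : ℕ → ℕ} (h : Jittered x M u ρ)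
    (hu : ∀ a, u a ∈ Set.Ico (0 : ℝ) 1) {a : ℕ} (ha : a < M) :
    emptySlotLeft x M a = ((if u a < 1 / 2 then 2 * a + 1 else 2 * a : ℕ) : ℝ) / (2 * M) := by
  have hev : ∀ b < M, (IsEmptySlot x M (2 * b) ↔ ¬ u b < 1 / 2) := by
    intro b hb
    rw [h.isEmptySlot_iff hu, show 2 * b / 2 = b by omega]
    by_cases h' : u b < 1 / 2
    · rw [if_pos h']
      exact ⟨fun H => by omega, fun H => absurd h' H⟩
    · rw [if_neg h']
      exact ⟨fun _ => h', fun _ => ⟨by omega, rfl⟩⟩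
  have hod : ∀ b < M, (IsEmptySlot x M (2 * b + 1) ↔ u b < 1 / 2) := by
    intro b hb
    rw [h.isEmptySlot_iff hu, show (2 * b + 1) / 2 = b by omega]
    by_cases h' : u b < 1 / 2
    · rw [if_pos h']
      exact ⟨fun _ => h', fun _ => ⟨by omega, rfl⟩⟩
    · rw [if_neg h']
      exact ⟨fun H => by omega, fun H => absurd H h'⟩
  have hcount : ∀ b ≤ M, Nat.count (IsEmptySlot x M) (2 * b) = b := by
    intro b hb
    induction b with
    | zero => simp
    | succ b ih =>
      rw [show 2 * (b + 1) = 2 * b + 1 + 1 by ring, Nat.count_succ, Nat.count_succ,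
        ih (by omega)]
      simp only [hev b (by omega), hod b (by omega)]
      split_ifs <;> omega
  unfold emptySlotLeft
  congr 2
  split_ifs with h'
  · have h2 : Nat.count (IsEmptySlot x M) (2 * a + 1) = a := by
      rw [Nat.count_succ, hcount a ha.le, if_neg (by rw [hev a ha]; simpa using h')]
      omega
    conv_lhs => rw [← h2]
    exact Nat.nth_count ((hod a ha).2 h')
  · conv_lhs => rw [← hcount a ha.le]
    exact Nat.nth_count ((hev a ha).2 h')

/-- The construction, for one outcome of the random permutations and points. -/
structure Built (x : ℕ → ℝ) (p : (t : ℕ) → Equiv.Perm (Fin (stageSize t))) (z : ℕ → ℝ) :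
    Prop where
  pos : ∀ m, z m ∈ Set.Ico (0 : ℝ) 1
  init : ∀ k < 2, x k = (rankAt p 0 k + z k) / 2
  step : ∀ n : ℕ, ∀ k < 2 ^ (n + 1), x (2 ^ (n + 1) + k) =
    emptySlotLeft x (2 ^ (n + 1)) (rankAt p (n + 1) k) +
      z (2 ^ (n + 1) + k) / (2 * 2 ^ (n + 1))

lemma cellPos_succ_even (n a : ℕ) : cellPos p z (n + 1) (2 * a) =
    if cellPos p z n a < 1 / 2 then 2 * cellPos p z n a else slotPos p z (n + 1) a := by
  rw [cellPos, if_pos (by omega), show 2 * a / 2 = a by omega, halve]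
  split_ifs <;> rfl

lemma cellPos_succ_odd (n a : ℕ) : cellPos p z (n + 1) (2 * a + 1) =
    if cellPos p z n a < 1 / 2 then slotPos p z (n + 1) a else 2 * cellPos p z n a - 1 := by
  rw [cellPos, if_neg (by omega), show (2 * a + 1) / 2 = a by omega, halve]
  split_ifs <;> rfl

lemma Built.step_eq (h : Built x p z) {n : ℕ} {ρ : ℕ → ℕ}
    (hρ : Jittered x (2 ^ (n + 1)) (cellPos p z n) ρ) {k : ℕ} (hk : k < 2 ^ (n + 1)) :
    x (2 ^ (n + 1) + k) =
      (((if cellPos p z n (rankAt p (n + 1) k) < 1 / 2 then 2 * rankAt p (n + 1) k + 1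
        else 2 * rankAt p (n + 1) k : ℕ) : ℝ) + z (2 ^ (n + 1) + k)) / (2 * 2 ^ (n + 1)) := by
  rw [h.step n k hk, hρ.emptySlotLeft_eq (cellPos_mem h.pos n) (rankAt_lt hk), add_div]
  push_cast
  rfl

/-- In each cell the old point keeps its half and the new point takes the other one, so every
half-cell ends up with one point. The recursion in `cellPos` records the rescaled positions. -/
lemma Jittered.succ (h : Built x p z) {n : ℕ} {ρ : ℕ → ℕ}
    (hρ : Jittered x (2 ^ (n + 1)) (cellPos p z n) ρ) :
    ∃ ρ', Jittered x (2 ^ (n + 2)) (cellPos p z (n + 1)) ρ' := by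
  have hpow : 2 ^ (n + 2) = 2 ^ (n + 1) + 2 ^ (n + 1) := by ring
  have hpowR : ((2 ^ (n + 2) : ℕ) : ℝ) = 2 * 2 ^ (n + 1) := by push_cast; ring
  have hst : ∀ k < 2 ^ (n + 1),
      x (2 ^ (n + 1) + k) = ((if cellPos p z n (rankAt p (n + 1) k) < 1 / 2 then
        2 * rankAt p (n + 1) k + 1 else 2 * rankAt p (n + 1) k : ℕ) +
          slotPos p z (n + 1) (rankAt p (n + 1) k)) / (2 * 2 ^ (n + 1)) := by
    intro k hk
    rw [slotPos_rankAt hk]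
    exact h.step_eq hρ hk
  have ha_lt' : ∀ k < 2 ^ (n + 1), rankAt p (n + 1) k < 2 ^ (n + 1) :=
    fun k hk => rankAt_lt hk
  have ha_inj' : ∀ k < 2 ^ (n + 1), ∀ l < 2 ^ (n + 1),
      rankAt p (n + 1) k = rankAt p (n + 1) l → k = l := fun k hk l hl => rankAt_inj hk hl
  have hM1 : ((2 ^ (n + 1) : ℕ) : ℝ) = 2 ^ (n + 1) := by push_cast; rfl
  generalize hM : 2 ^ (n + 1) = M at *
  set a : ℕ → ℕ := fun i => rankAt p (n + 1) (i - M) with ha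
  have ha_lt : ∀ i, M ≤ i → i < M + M → a i < M := fun i h1 h2 => ha_lt' _ (by omega)
  have ha_inj : ∀ i j, M ≤ i → i < M + M → M ≤ j → j < M + M → a i = a j → i = j := by
    intro i j h1 h2 h3 h4 e
    have := ha_inj' (i - M) (by omega) (j - M) (by omega) e
    omega
  set ρ' : ℕ → ℕ := fun i =>
    if i < M then (if cellPos p z n (ρ i) < 1 / 2 then 2 * ρ i else 2 * ρ i + 1)
    else (if cellPos p z n (a i) < 1 / 2 then 2 * a i + 1 else 2 * a i) with hρ'
  refine ⟨ρ', ?_, ?_, ?_⟩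
  · intro i hi
    simp only [hρ']
    by_cases him : i < M
    · have := hρ.lt i him
      rw [if_pos him]
      split_ifs <;> omega
    · have := ha_lt i (by omega) (by omega)
      rw [if_neg him]
      split_ifs <;> omega
  · intro i hi j hj e
    simp only [hρ'] at e
    by_cases him : i < M <;> by_cases hjm : j < M
    · rw [if_pos him, if_pos hjm] at e
      refine hρ.inj i him j hjm ?_
      split_ifs at e <;> omega
    · exfalso
      rw [if_pos him, if_neg hjm] at e
      -- Equal half-cells lie in the same old cell, where the old and the new point occupy opposite
      -- halves.
      have e' : a j = ρ i := by split_ifs at e <;> omega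
      rw [e'] at e
      split_ifs at e <;> omega
    · exfalso
      rw [if_neg him, if_pos hjm] at e
      have e' : a i = ρ j := by split_ifs at e <;> omega
      rw [e'] at e
      split_ifs at e <;> omega
    · rw [if_neg him, if_neg hjm] at e
      refine ha_inj i j (by omega) (by omega) (by omega) (by omega) ?_
      split_ifs at e <;> omega
  · intro i hi
    rw [hpowR]
    by_cases him : i < M
    · rw [hρ.eq i him]
      simp only [hρ', if_pos him]
      have hM0 : (M : ℝ) ≠ 0 := by rw [hM1]; positivity
      rw [← hM1]
      split_ifs with h'
      · rw [cellPos_succ_even, if_pos h']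
        push_cast
        field_simp
      · rw [cellPos_succ_odd, if_neg h']
        push_cast
        field_simp
        ring
    · have hk : i - M < M := by omega
      have := hst (i - M) hk
      rw [show M + (i - M) = i by omega] at this
      rw [this]
      simp only [hρ', if_neg him, ha]
      congr 2
      split_ifs with h'
      · rw [cellPos_succ_odd, if_pos h']
      · rw [cellPos_succ_even, if_neg h']

lemma Built.jittered (h : Built x p z) (n : ℕ) :
    ∃ ρ, Jittered x (2 ^ (n + 1)) (cellPos p z n) ρ := by
  induction n with
  | zero =>
    refine ⟨rankAt p 0, fun i hi => rankAt_lt (t := 0) hi,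
      fun i hi j hj e => rankAt_inj (t := 0) hi hj e,
      fun i hi => ?_⟩
    have h2 := slotPos_rankAt (p := p) (z := z) (t := 0) (k := i) hi
    rw [cellPos, h2, h.init i hi]
    simp [stageStart]
  | succ n ih =>
    obtain ⟨ρ, hρ⟩ := ih
    exact hρ.succ h

/-! ### Pair correlations at the scale of one cell, and the failure of PPC. -/

lemma distInt_le_of_int {y r : ℝ} (m : ℤ) (h : |y - m| ≤ r) : distInt y ≤ r :=
  (round_le y m).trans h

lemma exists_int_of_distInt_le {y r : ℝ} (h : distInt y ≤ r) : ∃ m : ℤ, |y - m| ≤ r :=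
  ⟨round y, h⟩

lemma eq_succ_mod {a b M : ℕ} (hb : b < M) {m : ℤ} (h : (b : ℤ) = a + 1 - m * M) :
    b = (a + 1) % M := by
  have h1 : ((b : ℤ)) % M = ((a : ℤ) + 1) % M := by
    rw [h, Int.sub_mul_emod_self_right]
  have h2 : b % M = (a + 1) % M := by exact_mod_cast h1
  rwa [Nat.mod_eq_of_lt hb] at h2

lemma exists_eq_of_succ_mod {a b M : ℕ} (h : b = (a + 1) % M) :
    ∃ m : ℤ, (b : ℤ) = a + 1 - m * M := by
  refine ⟨((a + 1) / M : ℕ), ?_⟩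
  have := Nat.mod_add_div (a + 1) M
  rw [← h] at this
  zify at this
  push_cast
  linarith

lemma distInt_cells_le_iff {M a b : ℕ} {u : ℕ → ℝ} (hu : ∀ a, u a ∈ Set.Ico (0 : ℝ) 1)
    (ha : a < M) (hb : b < M) (hab : a ≠ b) {s : ℝ} (hs : s ≤ 1) :
    distInt (((a : ℝ) + u a) / M - ((b : ℝ) + u b) / M) ≤ s / M ↔
      (b = (a + 1) % M ∧ 1 - s ≤ u a - u b) ∨ (a = (b + 1) % M ∧ 1 - s ≤ u b - u a) := by
  have hM : (0 : ℝ) < M := by exact_mod_cast (Nat.zero_le a).trans_lt ha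
  obtain ⟨ha0, ha1⟩ := hu a
  obtain ⟨hb0, hb1⟩ := hu b
  have key : ∀ m : ℤ, |((a : ℝ) + u a) / M - ((b : ℝ) + u b) / M - m| ≤ s / M ↔
      |((a - b - m * M : ℤ) : ℝ) + (u a - u b)| ≤ s := by
    intro m
    have : ((a : ℝ) + u a) / M - ((b : ℝ) + u b) / M - m =
        (((a - b - m * M : ℤ) : ℝ) + (u a - u b)) / M := by
      push_cast
      field_simp
      ring
    rw [this, abs_div, abs_of_pos hM, div_le_div_iff_of_pos_right hM]
  constructor
  · intro h
    obtain ⟨m, hm⟩ := exists_int_of_distInt_le h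
    rw [key, abs_le] at hm
    -- `d` is the offset of the cells after unwinding the circle. Relative positions differ by less
    -- than `1` and `s ≤ 1`, so `|d| < 2`.
    set d : ℤ := a - b - m * M with hd
    have h1 : (d : ℝ) < (2 : ℤ) := by push_cast; linarith [hm.2]
    have h2 : ((-2 : ℤ) : ℝ) < d := by push_cast; linarith [hm.1]
    have h1' := Int.cast_lt.mp h1
    have h2' := Int.cast_lt.mp h2
    have hd0 : d ≠ 0 := by
      intro h0
      rw [h0] at hd
      have h3 : (a : ℤ) = b + m * M := by linarith
      have h4 : (a : ℤ) % M = (b : ℤ) % M := by rw [h3, Int.add_mul_emod_self_right]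
      have h5 : a % M = b % M := by exact_mod_cast h4
      rw [Nat.mod_eq_of_lt ha, Nat.mod_eq_of_lt hb] at h5
      exact hab h5
    have : d = 1 ∨ d = -1 := by omega
    rcases this with h3 | h3
    · right
      rw [h3] at hd hm
      refine ⟨eq_succ_mod ha (m := -m) (by linarith), ?_⟩
      have := hm.2
      push_cast at this
      linarith
    · left
      rw [h3] at hd hm
      refine ⟨eq_succ_mod hb (m := m) (by linarith), ?_⟩
      have := hm.1
      push_cast at this
      linarith
  · rintro (⟨h1, h2⟩ | ⟨h1, h2⟩)
    · obtain ⟨m, hm⟩ := exists_eq_of_succ_mod h1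
      refine distInt_le_of_int m ((key m).2 ?_)
      rw [show (a : ℤ) - b - m * M = -1 by linarith, abs_le]
      push_cast
      constructor <;> linarith
    · obtain ⟨m, hm⟩ := exists_eq_of_succ_mod h1
      refine distInt_le_of_int (-m) ((key (-m)).2 ?_)
      rw [show (a : ℤ) - b - -m * M = 1 by linarith, abs_le]
      push_cast
      constructor <;> linarith

open Classical in
lemma Jittered.card_pairs {x : ℕ → ℝ} {M : ℕ} {u : ℕ → ℝ} {ρ : ℕ → ℕ}
    (h : Jittered x M u ρ) (hu : ∀ a, u a ∈ Set.Ico (0 : ℝ) 1) (hM : 3 ≤ M) {s : ℝ}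
    (hs : s ≤ 1) :
    ((Finset.range M ×ˢ Finset.range M).filter fun q =>
      q.1 ≠ q.2 ∧ distInt (x q.1 - x q.2) ≤ s / M).card =
    2 * ((Finset.range M).filter fun a => 1 - s ≤ u a - u ((a + 1) % M)).card := by
  set A := (Finset.range M).filter fun a => 1 - s ≤ u a - u ((a + 1) % M) with hA
  have hne : ∀ a < M, a ≠ (a + 1) % M := by
    intro a ha
    rcases Nat.lt_or_ge (a + 1) M with h' | h'
    · rw [Nat.mod_eq_of_lt h']; omega
    · rw [show a + 1 = M by omega, Nat.mod_self]; omega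
  -- Going forward twice does not return to the start, which would fail for `M = 2`. This keeps the
  -- two orientations of a neighbouring pair disjoint.
  have hne2 : ∀ a < M, a ≠ ((a + 1) % M + 1) % M := by
    intro a ha
    rcases Nat.lt_or_ge (a + 1) M with h' | h'
    · rw [Nat.mod_eq_of_lt h']
      rcases Nat.lt_or_ge (a + 2) M with h'' | h''
      · rw [Nat.mod_eq_of_lt h'']; omega
      · rw [show a + 1 + 1 = M by omega, Nat.mod_self]; omega
    · rw [show a + 1 = M by omega, Nat.mod_self, Nat.mod_eq_of_lt (by omega)]; omega
  have hlt : ∀ a, (a + 1) % M < M := fun a => Nat.mod_lt _ (by omega)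
  have h1 : ((Finset.range M ×ˢ Finset.range M).filter fun q =>
      q.1 ≠ q.2 ∧ distInt (x q.1 - x q.2) ≤ s / M).card =
      (A.image (fun a => (a, (a + 1) % M)) ∪ A.image (fun a => ((a + 1) % M, a))).card := by
    refine Finset.card_bij (fun q _ => (ρ q.1, ρ q.2)) ?_ ?_ ?_
    · rintro ⟨i, j⟩ hq
      simp only [Finset.mem_filter, Finset.mem_product, Finset.mem_range] at hq
      obtain ⟨⟨hi, hj⟩, hij, hd⟩ := hq
      have hρ : ρ i ≠ ρ j := fun e => hij (h.inj i hi j hj e)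
      rw [h.eq i hi, h.eq j hj,
        distInt_cells_le_iff hu (h.lt i hi) (h.lt j hj) hρ hs] at hd
      simp only [Finset.mem_union, Finset.mem_image, hA, Finset.mem_filter,
        Finset.mem_range, Prod.mk.injEq]
      rcases hd with ⟨h3, h4⟩ | ⟨h3, h4⟩
      · exact Or.inl ⟨ρ i, ⟨h.lt i hi, by rwa [← h3]⟩, rfl, h3.symm⟩
      · exact Or.inr ⟨ρ j, ⟨h.lt j hj, by rwa [← h3]⟩, h3.symm, rfl⟩
    · rintro ⟨i, j⟩ hq ⟨i', j'⟩ hq' e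
      simp only [Finset.mem_filter, Finset.mem_product, Finset.mem_range] at hq hq'
      simp only [Prod.mk.injEq] at e ⊢
      exact ⟨h.inj _ hq.1.1 _ hq'.1.1 e.1, h.inj _ hq.1.2 _ hq'.1.2 e.2⟩
    · rintro ⟨a, b⟩ hq
      have hab : a < M ∧ b < M ∧ a ≠ b ∧ ((b = (a + 1) % M ∧ 1 - s ≤ u a - u b) ∨
          (a = (b + 1) % M ∧ 1 - s ≤ u b - u a)) := by
        simp only [Finset.mem_union, Finset.mem_image, hA, Finset.mem_filter,
          Finset.mem_range, Prod.mk.injEq] at hq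
        rcases hq with ⟨c, ⟨h3, h4⟩, rfl, rfl⟩ | ⟨c, ⟨h3, h4⟩, rfl, rfl⟩
        · exact ⟨h3, hlt _, hne _ h3, Or.inl ⟨rfl, h4⟩⟩
        · exact ⟨hlt _, h3, (hne _ h3).symm, Or.inr ⟨rfl, h4⟩⟩
      obtain ⟨ha, hb, hne', hd⟩ := hab
      obtain ⟨i, hi, rfl⟩ := h.surj ha
      obtain ⟨j, hj, rfl⟩ := h.surj hb
      refine ⟨(i, j), ?_, rfl⟩
      simp only [Finset.mem_filter, Finset.mem_product, Finset.mem_range]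
      refine ⟨⟨hi, hj⟩, fun e => hne' (by rw [e]), ?_⟩
      rw [h.eq i hi, h.eq j hj, distInt_cells_le_iff hu ha hb hne' hs]
      exact hd
  rw [h1, Finset.card_union_of_disjoint, Finset.card_image_of_injective,
    Finset.card_image_of_injective, two_mul]
  · intro a b e
    simpa using (Prod.mk.inj e).2
  · intro a b e
    simpa using (Prod.mk.inj e).1
  · rw [Finset.disjoint_left]
    rintro ⟨a, b⟩ hq hq'
    simp only [Finset.mem_image, hA, Finset.mem_filter, Finset.mem_range,
      Prod.mk.injEq] at hq hq'
    obtain ⟨c, ⟨h3, -⟩, rfl, rfl⟩ := hq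
    obtain ⟨d, -, h5, h6⟩ := hq'
    subst h6
    exact hne2 c h3 h5.symm

open Classical in
lemma Jittered.pairCorr_one {x : ℕ → ℝ} {M : ℕ} {u : ℕ → ℝ} {ρ : ℕ → ℕ}
    (h : Jittered x M u ρ) (hu : ∀ a, u a ∈ Set.Ico (0 : ℝ) 1) (hM : 3 ≤ M) {s : ℝ}
    (hs : s ≤ 1) :
    pairCorr 1 s x M = 2 *
      ((((Finset.range M).filter fun a => 1 - s ≤ u a - u ((a + 1) % M)).card : ℝ) / M) := by
  unfold pairCorr
  rw [show (2 : ℝ) - 1 = 1 by norm_num, Real.rpow_one, h.card_pairs hu hM hs]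
  push_cast
  ring

open Classical in
/-- The increments around the circle sum up to `0`; hence they cannot be mostly nonnegative and
at least `1 / 2` too often. -/
lemma half_card_drops_le {M : ℕ} {u : ℕ → ℝ} (hu : ∀ a, u a ∈ Set.Ico (0 : ℝ) 1) :
    (((Finset.range M).filter fun a => 1 - 1 / 2 ≤ u a - u ((a + 1) % M)).card : ℝ) / 2 ≤
      M - (((Finset.range M).filter fun a => (1 : ℝ) - 1 ≤ u a - u ((a + 1) % M)).card : ℝ) := by
  have hsum : ∑ a ∈ Finset.range M, (u a - u ((a + 1) % M)) = 0 := by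
    rw [Finset.sum_sub_distrib, sub_eq_zero]
    cases M with
    | zero => simp
    | succ M =>
      rw [Finset.sum_range_succ' u, Finset.sum_range_succ (fun a => u ((a + 1) % (M + 1)))]
      congr 1
      · refine Finset.sum_congr rfl fun a ha => ?_
        rw [Nat.mod_eq_of_lt]
        have := Finset.mem_range.mp ha
        omega
      · simp
  -- A negative increment is still at least `-1`; this accounts for the summand `- 1`.
  have hpt : ∀ a ∈ Finset.range M,
      (if 1 - 1 / 2 ≤ u a - u ((a + 1) % M) then (1 / 2 : ℝ) else 0) +
        (if (1 : ℝ) - 1 ≤ u a - u ((a + 1) % M) then (1 : ℝ) else 0) - 1 ≤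
          u a - u ((a + 1) % M) := by
    intro a _
    have h1 := hu a
    have h2 := hu ((a + 1) % M)
    rw [Set.mem_Ico] at h1 h2
    split_ifs <;> linarith
  have := Finset.sum_le_sum hpt
  rw [hsum, Finset.sum_sub_distrib, Finset.sum_add_distrib, ← Finset.sum_filter,
    ← Finset.sum_filter] at this
  simp only [Finset.sum_const, nsmul_eq_mul, mul_one, Finset.card_range] at this
  linarith

lemma tendsto_two_pow_succ : Tendsto (fun n : ℕ => 2 ^ (n + 1)) atTop atTop :=
  (tendsto_pow_atTop_atTop_of_one_lt (r := 2) (by norm_num)).comp (tendsto_add_atTop_nat 1)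

/-- Under PPC the values at `s = 1 / 2` and `s = 1` tend to `1` and `2`, and the increment
inequality becomes `1 / 4 ≤ 0` in the limit. -/
lemma Built.not_hasPPC_one (h : Built x p z) : ¬ HasPPC 1 x := by
  classical
  intro H
  have h1 := (H 1 one_pos).comp tendsto_two_pow_succ
  have h2 := (H (1 / 2) (by norm_num)).comp tendsto_two_pow_succ
  have h3 : ∀ᶠ n : ℕ in atTop,
      pairCorr 1 (1 / 2) x (2 ^ (n + 1)) / 4 ≤ 1 - pairCorr 1 1 x (2 ^ (n + 1)) / 2 := by
    filter_upwards [eventually_ge_atTop 1] with n hn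
    have hM : 3 ≤ 2 ^ (n + 1) := by
      calc 3 ≤ 2 ^ (1 + 1) := by norm_num
        _ ≤ _ := Nat.pow_le_pow_right (by norm_num) (by omega)
    obtain ⟨ρ, hρ⟩ := h.jittered n
    have hu := cellPos_mem (p := p) h.pos n
    rw [hρ.pairCorr_one hu hM le_rfl, hρ.pairCorr_one hu hM (by norm_num)]
    have hle := half_card_drops_le (M := 2 ^ (n + 1)) hu
    generalize 2 ^ (n + 1) = M at *
    have hM0 : (0 : ℝ) < M := by
      have : 0 < M := by omega
      exact_mod_cast this
    have := div_le_div_of_nonneg_right hle hM0.le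
    rw [sub_div, div_self hM0.ne', div_right_comm] at this
    linarith
  have h4 := le_of_tendsto_of_tendsto (h2.div_const 4) ((h1.div_const 2).const_sub 1) h3
  norm_num at h4

end Outcome

/-! ### The uniform law and its invariance under halving a cell. -/

/-- The uniform distribution on `[0, 1)`. -/
noncomputable def unif : Measure ℝ := volume.restrict (Set.Ico 0 1)

instance : IsProbabilityMeasure unif := ⟨by simp [unif]⟩

lemma unif_left_half {s : Set ℝ} (hs : MeasurableSet s) :
    unif {u | u < 1 / 2 ∧ 2 * u ∈ s} = 2⁻¹ * unif s := by
  have hm : MeasurableSet {u : ℝ | u < 1 / 2 ∧ 2 * u ∈ s} :=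
    measurableSet_Iio.inter ((measurable_const_mul 2) hs)
  rw [unif, Measure.restrict_apply hm, Measure.restrict_apply hs]
  have : {u : ℝ | u < 1 / 2 ∧ 2 * u ∈ s} ∩ Set.Ico 0 1 =
      (fun u => 2 * u) ⁻¹' (s ∩ Set.Ico 0 1) := by
    ext u
    simp only [Set.mem_inter_iff, Set.mem_ofPred_eq, Set.mem_Ico, Set.mem_preimage]
    constructor
    · rintro ⟨⟨h1, h2⟩, h3, h4⟩
      exact ⟨h2, by linarith, by linarith⟩
    · rintro ⟨h1, h2, h3⟩
      exact ⟨⟨by linarith, h1⟩, by linarith, by linarith⟩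
  rw [this, Real.volume_preimage_mul_left (by norm_num)]
  congr 1
  rw [abs_of_pos (by norm_num), ENNReal.ofReal_inv_of_pos (by norm_num)]
  simp

lemma unif_right_half {s : Set ℝ} (hs : MeasurableSet s) :
    unif {u | ¬ u < 1 / 2 ∧ 2 * u - 1 ∈ s} = 2⁻¹ * unif s := by
  have hm : MeasurableSet {u : ℝ | ¬ u < 1 / 2 ∧ 2 * u - 1 ∈ s} :=
    measurableSet_Iio.compl.inter (((measurable_const_mul 2).sub_const 1) hs)
  rw [unif, Measure.restrict_apply hm, Measure.restrict_apply hs]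
  have : {u : ℝ | ¬ u < 1 / 2 ∧ 2 * u - 1 ∈ s} ∩ Set.Ico 0 1 =
      (fun u => 2 * u) ⁻¹' ((fun u => u + (-1)) ⁻¹' (s ∩ Set.Ico 0 1)) := by
    ext u
    simp only [Set.mem_inter_iff, Set.mem_ofPred_eq, Set.mem_Ico, Set.mem_preimage, not_lt,
      ← sub_eq_add_neg]
    constructor
    · rintro ⟨⟨h1, h2⟩, h3, h4⟩
      exact ⟨h2, by linarith, by linarith⟩
    · rintro ⟨h1, h2, h3⟩
      exact ⟨⟨by linarith, h1⟩, by linarith, by linarith⟩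
  rw [this, Real.volume_preimage_mul_left (by norm_num), measure_preimage_add_right]
  congr 1
  rw [abs_of_pos (by norm_num), ENNReal.ofReal_inv_of_pos (by norm_num)]
  simp

lemma measurable_halve : Measurable halve := by
  unfold halve
  exact Measurable.ite (measurableSet_lt measurable_fst measurable_const)
    ((measurable_fst.const_mul 2).prodMk measurable_snd)
    (measurable_snd.prodMk ((measurable_fst.const_mul 2).sub_const 1))

/-- Given the half that contains it, the old point is again uniform after rescaling, and the new
point is independent of it. The two cases contribute half of the product measure each. -/
lemma measurePreserving_halve : MeasurePreserving halve (unif.prod unif) (unif.prod unif) := by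
  refine ⟨measurable_halve, ?_⟩
  symm
  refine Measure.prod_eq fun s t hs ht => ?_
  rw [Measure.map_apply measurable_halve (hs.prod ht)]
  have : halve ⁻¹' (s ×ˢ t) = ({u : ℝ | u < 1 / 2 ∧ 2 * u ∈ s} ×ˢ t) ∪
      ({u : ℝ | ¬ u < 1 / 2 ∧ 2 * u - 1 ∈ t} ×ˢ s) := by
    ext ⟨u, w⟩
    simp only [halve, Set.mem_preimage, Set.mem_prod, Set.mem_union, Set.mem_ofPred_eq]
    split_ifs with h <;> tauto
  have hm : MeasurableSet {u : ℝ | ¬ u < 1 / 2 ∧ 2 * u - 1 ∈ t} :=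
    measurableSet_Iio.compl.inter (((measurable_const_mul 2).sub_const 1) ht)
  rw [this, measure_union _ (hm.prod hs), Measure.prod_prod, Measure.prod_prod,
    unif_left_half hs, unif_right_half ht, mul_assoc, mul_assoc,
    mul_comm (unif t) (unif s), ← add_mul, ENNReal.inv_two_add_inv_two, one_mul]
  rw [Set.disjoint_left]
  rintro ⟨u, w⟩ h1 h2
  exact h2.1.1 h1.1.1

/-- The set is a right triangle with legs `1 / 2`. -/
lemma unif_drop : (unif.prod unif) {q : ℝ × ℝ | 1 - 1 / 2 ≤ q.1 - q.2} = 8⁻¹ := by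
  have hm : MeasurableSet {q : ℝ × ℝ | 1 - 1 / 2 ≤ q.1 - q.2} :=
    measurableSet_le measurable_const (measurable_fst.sub measurable_snd)
  rw [Measure.prod_apply hm]
  have h1 : ∀ u ∈ Set.Ico (0 : ℝ) 1,
      unif (Prod.mk u ⁻¹' {q : ℝ × ℝ | 1 - 1 / 2 ≤ q.1 - q.2}) =
        ENNReal.ofReal (max (u - 1 / 2) 0) := by
    rintro u ⟨hu0, hu1⟩
    rw [unif, Measure.restrict_apply (measurable_prodMk_left hm)]
    have : Prod.mk u ⁻¹' {q : ℝ × ℝ | 1 - 1 / 2 ≤ q.1 - q.2} ∩ Set.Ico 0 1 =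
        Set.Icc 0 (u - 1 / 2) := by
      ext v
      simp only [Set.mem_inter_iff, Set.mem_preimage, Set.mem_ofPred_eq, Set.mem_Ico,
        Set.mem_Icc]
      constructor
      · rintro ⟨h1, h2, h3⟩
        exact ⟨h2, by linarith⟩
      · rintro ⟨h1, h2⟩
        exact ⟨by linarith, h1, by linarith⟩
    rw [this, Real.volume_Icc, sub_zero]
    rcases le_total (u - 1 / 2) 0 with h | h
    · rw [max_eq_right h, ENNReal.ofReal_of_nonpos h, ENNReal.ofReal_zero]
    · rw [max_eq_left h]
  have hc : Continuous fun u : ℝ => max (u - 1 / 2) 0 := by fun_prop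
  have h2 : ∫⁻ u, unif (Prod.mk u ⁻¹' {q : ℝ × ℝ | 1 - 1 / 2 ≤ q.1 - q.2}) ∂unif =
      ∫⁻ u in Set.Ico (0 : ℝ) 1, ENNReal.ofReal (max (u - 1 / 2) 0) :=
    setLIntegral_congr_fun measurableSet_Ico h1
  rw [h2,
    ← ofReal_integral_eq_lintegral_ofReal
      ((hc.integrableOn_Icc (a := 0) (b := 1)).mono_set Set.Ico_subset_Icc_self)
      (Eventually.of_forall fun u => le_max_right _ _),
    integral_Ico_eq_integral_Ioc, ← intervalIntegral.integral_of_le zero_le_one,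
    ← intervalIntegral.integral_add_adjacent_intervals (b := 1 / 2)
      (hc.intervalIntegrable _ _) (hc.intervalIntegrable _ _)]
  have e1 : ∫ u in (0 : ℝ)..(1 / 2), max (u - 1 / 2) 0 = 0 := by
    rw [intervalIntegral.integral_congr (g := fun _ => 0)]
    · simp
    · intro u hu
      rw [Set.uIcc_of_le (by norm_num)] at hu
      exact max_eq_right (by linarith [hu.2])
  have e2 : ∫ u in (1 / 2 : ℝ)..1, max (u - 1 / 2) 0 = 1 / 8 := by
    rw [intervalIntegral.integral_congr (g := fun u => u - 1 / 2)]
    · rw [intervalIntegral.integral_sub (by simp) (by simp)]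
      simp
      norm_num
    · intro u hu
      rw [Set.uIcc_of_le (by norm_num)] at hu
      exact max_eq_left (by linarith [hu.1])
  rw [e1, e2, zero_add, one_div, ENNReal.ofReal_inv_of_pos (by norm_num)]
  simp

/-! ### Joint laws of relative positions and the expectation. -/

section Law

variable {Ω : Type*} [MeasurableSpace Ω] {μ : Measure Ω}
  {perm : (t : ℕ) → Ω → Equiv.Perm (Fin (stageSize t))} {Z : ℕ → Ω → ℝ} {X : ℕ → Ω → ℝ}

lemma stageStart_add_lt {n k : ℕ} (hk : k < stageSize n) : stageStart n + k < 2 ^ (n + 1) := by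
  cases n with
  | zero => simpa [stageStart, stageSize] using hk
  | succ n =>
    simp only [stageStart, stageSize] at hk ⊢
    rw [pow_succ 2 (n + 1)]
    omega

lemma measurable_slotPos (t a : ℕ) (hp : Measurable (perm t))
    (hZ : ∀ k < stageSize t, Measurable (Z (stageStart t + k))) :
    Measurable fun ω => slotPos (fun t => perm t ω) (fun m => Z m ω) t a := by
  unfold slotPos
  split_ifs with h
  · have : (fun ω => Z (stageStart t + ((perm t ω).symm ⟨a, h⟩ : ℕ)) ω) = fun ω =>
        ∑ σ : Equiv.Perm (Fin (stageSize t)),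
          Set.indicator (perm t ⁻¹' {σ}) (Z (stageStart t + (σ.symm ⟨a, h⟩ : ℕ))) ω := by
      ext ω
      rw [Finset.sum_eq_single (perm t ω)]
      · rw [Set.indicator_of_mem (by simp)]
      · intro σ _ hσ
        rw [Set.indicator_of_notMem (by simpa using hσ.symm)]
      · simp
    rw [this]
    exact Finset.measurable_sum _ fun σ _ =>
      (hZ _ (σ.symm ⟨a, h⟩).2).indicator (hp (MeasurableSpace.measurableSet_top))
  · exact measurable_const

/-- Only the sources up to stage `n` are assumed measurable, so the lemma also applies to the
smaller `σ`-algebra that these sources generate; the independence of stages is derived this way. -/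
lemma measurable_cellPos (n a : ℕ) (hp : ∀ t ≤ n, Measurable (perm t))
    (hZ : ∀ k < 2 ^ (n + 1), Measurable (Z k)) :
    Measurable fun ω => cellPos (fun t => perm t ω) (fun m => Z m ω) n a := by
  induction n generalizing a with
  | zero => exact measurable_slotPos 0 a (hp 0 le_rfl) fun k hk => hZ _ (stageStart_add_lt hk)
  | succ n ih =>
    have h1 := ih (a / 2) (fun t ht => hp t (by omega))
      (fun k hk => hZ k (hk.trans (Nat.pow_lt_pow_right (by norm_num) (by omega))))
    have h2 := measurable_slotPos (n + 1) (a / 2) (hp (n + 1) le_rfl)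
      fun k hk => hZ _ (stageStart_add_lt hk)
    unfold cellPos
    split_ifs
    · exact measurable_fst.comp (measurable_halve.comp (h1.prodMk h2))
    · exact measurable_snd.comp (measurable_halve.comp (h1.prodMk h2))

/-- The `σ`-algebras generated by the single random objects. -/
abbrev source (perm : (t : ℕ) → Ω → Equiv.Perm (Fin (stageSize t))) (Z : ℕ → Ω → ℝ) :
    ℕ ⊕ ℕ → MeasurableSpace Ω
  | Sum.inl t => MeasurableSpace.comap (perm t) inferInstance
  | Sum.inr m => MeasurableSpace.comap (Z m) inferInstance

/-- Merging the permutations and the points into one independent family allows any two disjoint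
groups of sources to be separated. -/
lemma iIndep_source [IsProbabilityMeasure μ] (h : IsConstruction μ X perm Z) :
    iIndep (source perm Z) μ := by
  classical
  rw [iIndep_iff]
  intro S f hf
  have hP : iIndep (fun t => MeasurableSpace.comap (perm t) inferInstance) μ := h.indep_perm
  have hZ : iIndep (fun m => MeasurableSpace.comap (Z m) inferInstance) μ := h.indep_Z
  rw [iIndep_iff] at hP hZ
  have hPZ := (IndepFun_iff_Indep _ _ _).1 h.indep_perm_Z
  rw [Indep_iff] at hPZ
  have e1 := hP S.toLeft (f := fun t => f (Sum.inl t))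
    fun t ht => hf _ (by simpa using ht)
  have e2 := hZ S.toRight (f := fun t => f (Sum.inr t))
    fun t ht => hf _ (by simpa using ht)
  have e3 : (⋂ i ∈ S, f i) = (⋂ t ∈ S.toLeft, f (Sum.inl t)) ∩
      ⋂ m ∈ S.toRight, f (Sum.inr m) := by
    ext ω
    simp [Sum.forall]
  rw [e3, hPZ, e1, e2]
  · conv_rhs => rw [← Finset.toLeft_disjSum_toRight (u := S), Finset.prod_disjSum]
  · refine MeasurableSet.biInter S.toLeft.countable_toSet fun t ht => ?_
    have := hf (Sum.inl t) (by simpa using ht)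
    obtain ⟨E, hE, hE'⟩ := this
    exact ⟨(fun q => q t) ⁻¹' E, measurable_pi_apply t hE, hE'⟩
  · refine MeasurableSet.biInter S.toRight.countable_toSet fun t ht => ?_
    have := hf (Sum.inr t) (by simpa using ht)
    obtain ⟨E, hE, hE'⟩ := this
    exact ⟨(fun q => q t) ⁻¹' E, measurable_pi_apply t hE, hE'⟩

/-- The two pairs are functions of disjoint groups of sources: stages up to `n` with points of index
below `2 ^ (n + 1)`, and stage `n + 1` with the remaining points. -/
lemma indepFun_cellPos_slotPos [IsProbabilityMeasure μ] (h : IsConstruction μ X perm Z)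
    (n a b c d : ℕ) :
    IndepFun (fun ω => (cellPos (fun t => perm t ω) (fun m => Z m ω) n a,
        cellPos (fun t => perm t ω) (fun m => Z m ω) n b))
      (fun ω => (slotPos (fun t => perm t ω) (fun m => Z m ω) (n + 1) c,
        slotPos (fun t => perm t ω) (fun m => Z m ω) (n + 1) d)) μ := by
  set S : Set (ℕ ⊕ ℕ) := {i | Sum.elim (fun t => t ≤ n) (fun m => m < 2 ^ (n + 1)) i} with hS
  set T : Set (ℕ ⊕ ℕ) := {i | Sum.elim (fun t => t = n + 1) (fun m => 2 ^ (n + 1) ≤ m) i}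
    with hT
  have hle : ∀ i, source perm Z i ≤ ‹MeasurableSpace Ω› := by
    rintro (t | m)
    · exact (h.measurable_perm t).comap_le
    · exact (h.measurable_Z m).comap_le
  have hST : Disjoint S T := by
    rw [Set.disjoint_left]
    rintro (t | m) h1 h2
    · simp only [hS, hT, Set.mem_ofPred_eq, Sum.elim_inl] at h1 h2
      omega
    · simp only [hS, hT, Set.mem_ofPred_eq, Sum.elim_inr] at h1 h2
      omega
  have hI := indep_iSup_of_disjoint hle (iIndep_source h) hST
  have hperm : ∀ (R : Set (ℕ ⊕ ℕ)) (t : ℕ), Sum.inl t ∈ R →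
      Measurable[⨆ i ∈ R, source perm Z i] (perm t) := fun R t ht =>
    Measurable.mono (comap_measurable (perm t))
      (le_iSup₂ (f := fun i (_ : i ∈ R) => source perm Z i) (Sum.inl t) ht) le_rfl
  have hZ : ∀ (R : Set (ℕ ⊕ ℕ)) (m : ℕ), Sum.inr m ∈ R →
      Measurable[⨆ i ∈ R, source perm Z i] (Z m) := fun R m hm =>
    Measurable.mono (comap_measurable (Z m))
      (le_iSup₂ (f := fun i (_ : i ∈ R) => source perm Z i) (Sum.inr m) hm) le_rfl
  have hU : ∀ a, Measurable[⨆ i ∈ S, source perm Z i]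
      fun ω => cellPos (fun t => perm t ω) (fun m => Z m ω) n a := fun a =>
    @measurable_cellPos Ω (⨆ i ∈ S, source perm Z i) perm Z n a
      (fun t ht => hperm S t (by simpa [hS] using ht))
      (fun m hm => hZ S m (by simpa [hS] using hm))
  have hW : ∀ a, Measurable[⨆ i ∈ T, source perm Z i]
      fun ω => slotPos (fun t => perm t ω) (fun m => Z m ω) (n + 1) a := fun a =>
    @measurable_slotPos Ω (⨆ i ∈ T, source perm Z i) perm Z (n + 1) a
      (hperm T _ (by simp [hT])) (fun m hm => hZ T _ (by simp [hT, stageStart]))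
  rw [IndepFun_iff_Indep]
  exact indep_of_indep_of_le_left (indep_of_indep_of_le_right hI
    (Measurable.comap_le ((hW c).prodMk (hW d)))) (Measurable.comap_le ((hU a).prodMk (hU b)))

lemma measurePreserving_Z [IsProbabilityMeasure μ] (h : IsConstruction μ X perm Z) {i j : ℕ}
    (hij : i ≠ j) : MeasurePreserving (fun ω => (Z i ω, Z j ω)) μ (unif.prod unif) := by
  refine ⟨(h.measurable_Z i).prodMk (h.measurable_Z j), ?_⟩
  rw [(indepFun_iff_map_prod_eq_prod_map_map (h.measurable_Z i).aemeasurable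
    (h.measurable_Z j).aemeasurable).1 (h.indep_Z.indepFun hij), h.Z_uniform, h.Z_uniform]
  rfl

/-- On each event `perm t = σ` the two slots read two fixed distinct variables `Z i`, `Z j`, which
are independent of the permutation. -/
lemma measurePreserving_slotPos [IsProbabilityMeasure μ] (h : IsConstruction μ X perm Z)
    {t a b : ℕ} (ha : a < stageSize t) (hb : b < stageSize t) (hab : a ≠ b) :
    MeasurePreserving (fun ω => (slotPos (fun t => perm t ω) (fun m => Z m ω) t a,
      slotPos (fun t => perm t ω) (fun m => Z m ω) t b)) μ (unif.prod unif) := by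
  have hm : ∀ a, Measurable fun ω => slotPos (fun t => perm t ω) (fun m => Z m ω) t a :=
    fun a => measurable_slotPos t a (h.measurable_perm t) fun k _ => h.measurable_Z _
  refine ⟨(hm a).prodMk (hm b), ?_⟩
  ext E hE
  rw [Measure.map_apply ((hm a).prodMk (hm b)) hE]
  set q : Equiv.Perm (Fin (stageSize t)) → ℕ → ℕ := fun σ c =>
    if hc : c < stageSize t then stageStart t + (σ.symm ⟨c, hc⟩ : ℕ) else 0 with hq
  have hsum : (fun ω => (slotPos (fun t => perm t ω) (fun m => Z m ω) t a,
      slotPos (fun t => perm t ω) (fun m => Z m ω) t b)) ⁻¹' E =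
      ⋃ σ ∈ (Finset.univ : Finset (Equiv.Perm (Fin (stageSize t)))),
        (perm t ⁻¹' {σ} ∩ (fun ω => (Z (q σ a) ω, Z (q σ b) ω)) ⁻¹' E) := by
    ext ω
    simp [slotPos, ha, hb, hq]
  have hpm : ∀ σ, MeasurableSet (perm t ⁻¹' {σ}) := fun σ =>
    h.measurable_perm t MeasurableSpace.measurableSet_top
  have hZZ : ∀ i j, Measurable fun ω => (Z i ω, Z j ω) := fun i j =>
    (h.measurable_Z i).prodMk (h.measurable_Z j)
  rw [hsum, measure_biUnion_finset]
  · have hterm : ∀ σ : Equiv.Perm (Fin (stageSize t)),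
        μ (perm t ⁻¹' {σ} ∩ (fun ω => (Z (q σ a) ω, Z (q σ b) ω)) ⁻¹' E) =
          μ (perm t ⁻¹' {σ}) * (unif.prod unif) E := by
      intro σ
      have hne : q σ a ≠ q σ b := by
        simp only [hq, dif_pos ha, dif_pos hb]
        intro e
        have e1 := σ.symm.injective (Fin.ext (Nat.add_left_cancel e))
        exact hab (congrArg Fin.val e1)
      have hind : IndepFun (perm t) (fun ω => (Z (q σ a) ω, Z (q σ b) ω)) μ :=
        h.indep_perm_Z.comp (measurable_pi_apply t)
          ((measurable_pi_apply (q σ a)).prodMk (measurable_pi_apply (q σ b)))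
      rw [hind.measure_inter_preimage_eq_mul _ _ MeasurableSpace.measurableSet_top hE,
        (measurePreserving_Z h hne).measure_preimage hE.nullMeasurableSet]
    simp only [hterm]
    rw [← Finset.sum_mul, sum_measure_preimage_singleton _ fun σ _ => hpm σ]
    simp
  · intro σ _ τ _ hστ
    refine Disjoint.mono Set.inter_subset_left Set.inter_subset_left ?_
    exact Disjoint.preimage _ (by simpa using hστ)
  · exact fun σ _ => (hpm σ).inter (hZZ _ _ hE)

lemma measurePreserving_prodProdProdComm :
    MeasurePreserving (fun q : (ℝ × ℝ) × ℝ × ℝ => ((q.1.1, q.2.1), (q.1.2, q.2.2)))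
      ((unif.prod unif).prod (unif.prod unif)) ((unif.prod unif).prod (unif.prod unif)) := by
  have e : (fun q : (ℝ × ℝ) × ℝ × ℝ => ((q.1.1, q.2.1), (q.1.2, q.2.2))) =
      (MeasurableEquiv.prodAssoc (α := ℝ) (β := ℝ) (γ := ℝ × ℝ)).symm ∘
        (Prod.map id ((MeasurableEquiv.prodAssoc (α := ℝ) (β := ℝ) (γ := ℝ)) ∘
          (Prod.map Prod.swap id) ∘ (MeasurableEquiv.prodAssoc (α := ℝ) (β := ℝ)
            (γ := ℝ)).symm)) ∘
        (MeasurableEquiv.prodAssoc (α := ℝ) (β := ℝ) (γ := ℝ × ℝ)) := by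
    ext q <;> rfl
  rw [e]
  refine ((measurePreserving_prodAssoc unif unif (unif.prod unif)).symm _).comp
    (MeasurePreserving.comp ?_ (measurePreserving_prodAssoc unif unif (unif.prod unif)))
  refine (MeasurePreserving.id unif).prod ?_
  exact (measurePreserving_prodAssoc unif unif unif).comp
    ((Measure.measurePreserving_swap.prod (MeasurePreserving.id unif)).comp
      ((measurePreserving_prodAssoc unif unif unif).symm _))

/-- Induction over the stages. Two halves of one cell form an image under `halve`; halves of
different cells come from two independent uniform pairs. -/
lemma measurePreserving_cellPos [IsProbabilityMeasure μ] (h : IsConstruction μ X perm Z)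
    (n : ℕ) {a b : ℕ} (ha : a < 2 ^ (n + 1)) (hb : b < 2 ^ (n + 1)) (hab : a ≠ b) :
    MeasurePreserving (fun ω => (cellPos (fun t => perm t ω) (fun m => Z m ω) n a,
      cellPos (fun t => perm t ω) (fun m => Z m ω) n b)) μ (unif.prod unif) := by
  induction n generalizing a b with
  | zero => exact measurePreserving_slotPos (t := 0) h ha hb hab
  | succ n ih =>
    have hpow : 2 ^ (n + 1 + 1) = 2 ^ (n + 1) + 2 ^ (n + 1) := by ring
    have h2 : 2 ≤ 2 ^ (n + 1) := by
      calc 2 = 2 ^ 1 := by norm_num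
        _ ≤ _ := Nat.pow_le_pow_right (by norm_num) (by omega)
    set U : ℕ → Ω → ℝ := fun a ω => cellPos (fun t => perm t ω) (fun m => Z m ω) n a with hU
    set W : ℕ → Ω → ℝ := fun a ω =>
      slotPos (fun t => perm t ω) (fun m => Z m ω) (n + 1) a with hW
    have hUm : ∀ a, Measurable (U a) := fun a =>
      measurable_cellPos n a (fun t _ => h.measurable_perm t) fun k _ => h.measurable_Z k
    have hWm : ∀ a, Measurable (W a) := fun a =>
      measurable_slotPos (n + 1) a (h.measurable_perm _) fun k _ => h.measurable_Z _
    have hlaw : ∀ c < 2 ^ (n + 1), ∀ d < 2 ^ (n + 1), c ≠ d →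
        MeasurePreserving (fun ω => ((U c ω, W c ω), (U d ω, W d ω))) μ
          ((unif.prod unif).prod (unif.prod unif)) := by
      intro c hc d hd hcd
      have h4 : MeasurePreserving (fun ω => ((U c ω, U d ω), (W c ω, W d ω))) μ
          ((unif.prod unif).prod (unif.prod unif)) := by
        refine ⟨((hUm c).prodMk (hUm d)).prodMk ((hWm c).prodMk (hWm d)), ?_⟩
        rw [(indepFun_iff_map_prod_eq_prod_map_map ((hUm c).prodMk (hUm d)).aemeasurable
          ((hWm c).prodMk (hWm d)).aemeasurable).1 (indepFun_cellPos_slotPos h n c d c d)]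
        exact congrArg₂ Measure.prod (ih hc hd hcd).map_eq
          (measurePreserving_slotPos (t := n + 1) h hc hd hcd).map_eq
      exact measurePreserving_prodProdProdComm.comp h4
    have hhalf : ∀ c < 2 ^ (n + 1), MeasurePreserving (fun ω => halve (U c ω, W c ω)) μ
        (unif.prod unif) := by
      intro c hc
      -- A second cell is chosen only to read off the law of a single one as a marginal of `hlaw`.
      obtain ⟨d, hd, hcd⟩ : ∃ d < 2 ^ (n + 1), c ≠ d := by
        rcases Nat.eq_zero_or_pos c with rfl | h0
        · exact ⟨1, by omega, by omega⟩
        · exact ⟨0, by omega, by omega⟩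
      exact measurePreserving_halve.comp (measurePreserving_fst.comp (hlaw c hc d hd hcd))
    set g : ℕ → ℝ × ℝ → ℝ := fun a q => if a % 2 = 0 then q.1 else q.2 with hg
    have hgm : ∀ a, MeasurePreserving (g a) (unif.prod unif) unif := by
      intro a
      by_cases h' : a % 2 = 0
      · simp only [hg, h', if_true]
        exact measurePreserving_fst
      · simp only [hg, h', if_false]
        exact measurePreserving_snd
    have hcell : ∀ a ω, cellPos (fun t => perm t ω) (fun m => Z m ω) (n + 1) a =
        g a (halve (U (a / 2) ω, W (a / 2) ω)) := by
      intro a ω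
      rw [cellPos]
    simp only [hcell]
    by_cases hab2 : a / 2 = b / 2
    · rw [← hab2]
      have hM := hhalf (a / 2) (by omega)
      rcases Nat.mod_two_eq_zero_or_one a with h0 | h0
      · have h1 : b % 2 = 1 := by omega
        simpa [hg, h0, h1] using hM
      · have h1 : b % 2 = 0 := by omega
        simp only [hg, h0, h1, if_true, one_ne_zero, if_false]
        exact Measure.measurePreserving_swap.comp hM
    · have hM := hlaw (a / 2) (by omega) (b / 2) (by omega) hab2
      exact (((hgm a).comp measurePreserving_halve).prod
        ((hgm b).comp measurePreserving_halve)).comp hM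

lemma ae_built [IsProbabilityMeasure μ] (h : IsConstruction μ X perm Z) :
    ∀ᵐ ω ∂μ, Built (fun i => X i ω) (fun t => perm t ω) (fun m => Z m ω) := by
  have : ∀ m, ∀ᵐ ω ∂μ, Z m ω ∈ Set.Ico (0 : ℝ) 1 := by
    intro m
    have := ae_restrict_mem (μ := (volume : Measure ℝ)) (measurableSet_Ico (a := (0 : ℝ)) (b := 1))
    rw [← h.Z_uniform m] at this
    exact ae_of_ae_map (h.measurable_Z m).aemeasurable this
  filter_upwards [ae_all_iff.2 this] with ω hω
  refine ⟨hω, fun k hk => ?_, fun n k hk => ?_⟩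
  · rw [rankAt, dif_pos (show k < stageSize 0 from hk)]
    exact h.init ω ⟨k, hk⟩
  · rw [rankAt, dif_pos (show k < stageSize (n + 1) from hk)]
    exact h.step ω n ⟨k, hk⟩

/-- By linearity only the law of pairs of cells enters. The value is exact from four points on. -/
lemma integral_pairCorr [IsProbabilityMeasure μ] (h : IsConstruction μ X perm Z) {n : ℕ}
    (hn : 1 ≤ n) :
    ∫ ω, pairCorr 1 (1 / 2) (fun i => X i ω) (2 ^ (n + 1)) ∂μ = 1 / 4 := by
  classical
  have hM : 3 ≤ 2 ^ (n + 1) := by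
    calc 3 ≤ 2 ^ (1 + 1) := by norm_num
      _ ≤ _ := Nat.pow_le_pow_right (by norm_num) (by omega)
  set U : ℕ → Ω → ℝ := fun a ω => cellPos (fun t => perm t ω) (fun m => Z m ω) n a with hU
  have hUm : ∀ a, Measurable (U a) := fun a =>
    measurable_cellPos n a (fun t _ => h.measurable_perm t) fun k _ => h.measurable_Z k
  set A : ℕ → Set Ω := fun a =>
    {ω | 1 - 1 / 2 ≤ U a ω - U ((a + 1) % 2 ^ (n + 1)) ω} with hA
  have hAm : ∀ a, MeasurableSet (A a) := fun a =>
    measurableSet_le measurable_const ((hUm _).sub (hUm _))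
  have hAμ : ∀ a < 2 ^ (n + 1), μ.real (A a) = 1 / 8 := by
    intro a ha
    have hlt : (a + 1) % 2 ^ (n + 1) < 2 ^ (n + 1) := Nat.mod_lt _ (by omega)
    have hne : a ≠ (a + 1) % 2 ^ (n + 1) := by
      rcases Nat.lt_or_ge (a + 1) (2 ^ (n + 1)) with h' | h'
      · rw [Nat.mod_eq_of_lt h']; omega
      · rw [show a + 1 = 2 ^ (n + 1) by omega, Nat.mod_self]; omega
    have hm : MeasurableSet {q : ℝ × ℝ | 1 - 1 / 2 ≤ q.1 - q.2} :=
      measurableSet_le measurable_const (measurable_fst.sub measurable_snd)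
    have := (measurePreserving_cellPos h n ha hlt hne).measure_preimage hm.nullMeasurableSet
    rw [unif_drop] at this
    rw [Measure.real, show A a = _ from rfl]
    have e : μ (A a) = 8⁻¹ := this
    rw [e]
    simp
  have hae : ∀ᵐ ω ∂μ, pairCorr 1 (1 / 2) (fun i => X i ω) (2 ^ (n + 1)) =
      2 / (2 ^ (n + 1) : ℕ) * ∑ a ∈ Finset.range (2 ^ (n + 1)), (A a).indicator 1 ω := by
    filter_upwards [ae_built h] with ω hω
    obtain ⟨ρ, hρ⟩ := hω.jittered n
    rw [hρ.pairCorr_one (cellPos_mem hω.pos n) hM (by norm_num), Finset.card_filter]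
    simp only [hA, hU, Set.indicator_apply, Set.mem_ofPred_eq, Pi.one_apply]
    push_cast
    ring
  rw [integral_congr_ae hae, integral_const_mul, integral_finsetSum]
  · have : ∀ a ∈ Finset.range (2 ^ (n + 1)), ∫ ω, (A a).indicator (1 : Ω → ℝ) ω ∂μ = 1 / 8 := by
      intro a ha
      rw [integral_indicator_one (hAm a), hAμ a (Finset.mem_range.mp ha)]
    rw [Finset.sum_congr rfl this, Finset.sum_const, Finset.card_range, nsmul_eq_mul]
    have : ((2 ^ (n + 1) : ℕ) : ℝ) ≠ 0 := by positivity
    field_simp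
    norm_num
  · intro a _
    exact (integrable_const (1 : ℝ)).indicator (hAm a)

end Law

/-! ### Window sums on the circle of cells. -/

section Window

variable {M : ℕ}

/-- The sum of `f` over the window of `K` consecutive cells that starts at `b`. -/
def winSum (f : ZMod M → ℝ) (K : ℕ) (b : ZMod M) : ℝ := ∑ d ∈ Finset.range K, f (b + d)

lemma sum_shift [NeZero M] (g : ZMod M → ℝ) (t : ZMod M) : ∑ b, g (b + t) = ∑ b, g b :=
  Equiv.sum_comp (Equiv.addRight t) g

/-- A shift by one cell drops one term and adds one. -/
lemma abs_winSum_shift_sub_le {f : ZMod M → ℝ} (hf : ∀ a, |f a| ≤ 1) (K : ℕ) (b : ZMod M)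
    (e : ℕ) : |winSum f K (b + e) - winSum f K b| ≤ 2 * e := by
  induction e with
  | zero => simp
  | succ e ih =>
    have h1 : winSum f K (b + (e + 1 : ℕ)) - winSum f K (b + e) =
        f (b + e + K) - f (b + e) := by
      have := Finset.sum_range_sub (fun d : ℕ => f (b + e + d)) K
      simp only [Nat.cast_zero, add_zero] at this
      rw [← this, Finset.sum_sub_distrib, winSum, winSum]
      congr 1
      refine Finset.sum_congr rfl fun d _ => ?_
      push_cast
      congr 1
      ring
    have h2 := abs_sub_le (winSum f K (b + (e + 1 : ℕ))) (winSum f K (b + e)) (winSum f K b)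
    have h3 := abs_sub (f (b + e + K)) (f (b + e))
    rw [h1] at h2
    have h4 := hf (b + e + K)
    have h5 := hf (b + e)
    push_cast
    push_cast at h2
    linarith

/-- Summing a `K`-window over `B` shifts equals summing a `B`-window over `K` shifts; the shifts
cost at most `B * (2 * B)`. Fluctuations of short windows thereby control those of all longer ones.
-/
lemma mul_abs_winSum_le {f : ZMod M → ℝ} (hf : ∀ a, |f a| ≤ 1) (K B : ℕ) (b : ZMod M) :
    B * |winSum f K b| ≤ ∑ d ∈ Finset.range K, |winSum f B (b + d)| + 2 * B ^ 2 := by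
  have h1 : ∑ e ∈ Finset.range B, winSum f K (b + e) =
      ∑ d ∈ Finset.range K, winSum f B (b + d) := by
    simp only [winSum]
    rw [Finset.sum_comm]
    refine Finset.sum_congr rfl fun d _ => Finset.sum_congr rfl fun e _ => ?_
    congr 1
    ring
  have h2 : (B : ℝ) * winSum f K b = ∑ d ∈ Finset.range K, winSum f B (b + d) -
      ∑ e ∈ Finset.range B, (winSum f K (b + e) - winSum f K b) := by
    rw [Finset.sum_sub_distrib, h1]
    simp
  have h3 : |∑ e ∈ Finset.range B, (winSum f K (b + e) - winSum f K b)| ≤ 2 * B ^ 2 := by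
    refine (Finset.abs_sum_le_sum_abs _ _).trans ?_
    have : ∀ e ∈ Finset.range B, |winSum f K (b + e) - winSum f K b| ≤ 2 * B := by
      intro e he
      refine (abs_winSum_shift_sub_le hf K b e).trans ?_
      have : (e : ℝ) ≤ B := by exact_mod_cast (Finset.mem_range.mp he).le
      linarith
    refine (Finset.sum_le_card_nsmul _ _ _ this).trans (le_of_eq ?_)
    rw [Finset.card_range, nsmul_eq_mul]
    ring
  rw [← Nat.abs_cast B, ← abs_mul, h2]
  refine (abs_sub _ _).trans ?_
  rw [Nat.abs_cast]
  exact add_le_add (Finset.abs_sum_le_sum_abs _ _) h3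

lemma mul_sum_abs_winSum_le [NeZero M] {f : ZMod M → ℝ} (hf : ∀ a, |f a| ≤ 1) (K B : ℕ) :
    B * ∑ b, |winSum f K b| ≤ K * ∑ b, |winSum f B b| + 2 * B ^ 2 * M := by
  rw [Finset.mul_sum]
  refine (Finset.sum_le_sum fun b _ => mul_abs_winSum_le hf K B b).trans (le_of_eq ?_)
  rw [Finset.sum_add_distrib, Finset.sum_comm]
  simp only [sum_shift (fun b => |winSum f B b|)]
  simp [ZMod.card, mul_comm]

/-- Replacing the window count by its mean gives the main term exactly; the rest is a sum of window
fluctuations with weights at most `2`. -/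
lemma abs_corr_sub_le [NeZero M] {c f : ZMod M → ℝ} {N : ℝ} (hc : ∀ a, 0 ≤ c a ∧ c a ≤ 2)
    (hsum : ∑ a, c a = N) (hf : ∀ a, f a = c a - N / M) (K : ℕ) (t : ZMod M) :
    |∑ a, c a * winSum c K (a + t) - K * N ^ 2 / M| ≤ 2 * ∑ b, |winSum f K b| := by
  have h1 : ∀ a, winSum c K a = winSum f K a + K * (N / M) := by
    intro a
    simp only [winSum, hf, Finset.sum_sub_distrib]
    simp
  have h2 : ∑ a, c a * winSum c K (a + t) - K * N ^ 2 / M =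
      ∑ a, c a * winSum f K (a + t) := by
    simp only [h1, mul_add, Finset.sum_add_distrib]
    rw [← Finset.sum_mul, hsum]
    ring
  rw [h2, ← sum_shift (fun b => |winSum f K b|) t, Finset.mul_sum]
  refine (Finset.abs_sum_le_sum_abs _ _).trans (Finset.sum_le_sum fun a _ => ?_)
  rw [abs_mul, abs_of_nonneg (hc a).1]
  exact mul_le_mul_of_nonneg_right (hc a).2 (abs_nonneg _)

/-- The fluctuation of the number of indices `j < k` with `r j` in a given cell. -/
noncomputable def dev (M : ℕ) (r : ℕ → ℕ) (k : ℕ) (a : ZMod M) : ℝ :=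
  (∑ j ∈ Finset.range k, if (r j : ZMod M) = a then (1 : ℝ) else 0) - k / M

lemma cast_inj_of_lt {a b : ℕ} (ha : a < M) (hb : b < M) (h : (a : ZMod M) = b) : a = b := by
  have := (ZMod.natCast_eq_natCast_iff' a b M).1 h
  rwa [Nat.mod_eq_of_lt ha, Nat.mod_eq_of_lt hb] at this

lemma count_le_one {r : ℕ → ℕ} {k : ℕ} (hr : ∀ j < k, r j < M)
    (hinj : ∀ i < k, ∀ j < k, r i = r j → i = j) (a : ZMod M) :
    (∑ j ∈ Finset.range k, if (r j : ZMod M) = a then (1 : ℝ) else 0) ≤ 1 := by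
  rw [← Finset.sum_filter, Finset.sum_const, nsmul_eq_mul, mul_one]
  have : ((Finset.range k).filter fun j => (r j : ZMod M) = a).card ≤ 1 := by
    rw [Finset.card_le_one]
    intro i hi j hj
    simp only [Finset.mem_filter, Finset.mem_range] at hi hj
    exact hinj i hi.1 j hj.1
      (cast_inj_of_lt (hr i hi.1) (hr j hj.1) (hi.2.trans hj.2.symm))
  exact_mod_cast this

lemma count_nonneg (r : ℕ → ℕ) (k : ℕ) (a : ZMod M) :
    0 ≤ ∑ j ∈ Finset.range k, if (r j : ZMod M) = a then (1 : ℝ) else 0 :=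
  Finset.sum_nonneg fun _ _ => by split_ifs <;> norm_num

lemma count_eq_one [NeZero M] {ρ : ℕ → ℕ} (hlt : ∀ j < M, ρ j < M)
    (hinj : ∀ i < M, ∀ j < M, ρ i = ρ j → i = j) (a : ZMod M) :
    (∑ j ∈ Finset.range M, if (ρ j : ZMod M) = a then (1 : ℝ) else 0) = 1 := by
  refine le_antisymm (count_le_one hlt hinj a) ?_
  have : Set.SurjOn ρ (Finset.range M) (Finset.range M) :=
    Finset.surjOn_of_injOn_of_card_le ρ (fun i hi => by simpa using hlt i (by simpa using hi))
      (fun i hi j hj e => hinj i (by simpa using hi) j (by simpa using hj) e) le_rfl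
  obtain ⟨i, hi, e⟩ := this (by simpa using ZMod.val_lt a :
    a.val ∈ (Finset.range M : Set ℕ))
  have h1 := Finset.single_le_sum (f := fun j => if (ρ j : ZMod M) = a then (1 : ℝ) else 0)
    (fun j _ => by split_ifs <;> norm_num) hi
  simp only [e, ZMod.natCast_val, ZMod.cast_id', id_eq, if_true] at h1
  exact h1

lemma abs_dev_le_one {r : ℕ → ℕ} {k : ℕ} (hk : k ≤ M) (hr : ∀ j < k, r j < M)
    (hinj : ∀ i < k, ∀ j < k, r i = r j → i = j) (a : ZMod M) : |dev M r k a| ≤ 1 := by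
  have h1 := count_le_one hr hinj a
  have h2 := count_nonneg r k a
  have h3 : (k : ℝ) / M ≤ 1 := div_le_one_of_le₀ (by exact_mod_cast hk) (by positivity)
  have h4 : (0 : ℝ) ≤ (k : ℝ) / M := by positivity
  rw [dev, abs_le]
  constructor <;> linarith

lemma sum_abs_dev_sub_le [NeZero M] (r : ℕ → ℕ) (k l : ℕ) :
    ∑ a, |dev M r (k + l) a - dev M r k a| ≤ 2 * l := by
  have hM : (M : ℝ) ≠ 0 := by exact_mod_cast NeZero.ne M
  have h1 : ∀ a, |dev M r (k + l) a - dev M r k a| ≤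
      (∑ j ∈ Finset.range l, if (r (k + j) : ZMod M) = a then (1 : ℝ) else 0) + l / M := by
    intro a
    have h2 := count_nonneg (fun j => r (k + j)) l a
    have h4 : (0 : ℝ) ≤ (l : ℝ) / M := by positivity
    have e : dev M r (k + l) a - dev M r k a =
        (∑ j ∈ Finset.range l, if (r (k + j) : ZMod M) = a then (1 : ℝ) else 0) - l / M := by
      rw [dev, dev, Finset.sum_range_add]
      push_cast
      ring
    rw [e]
    refine (abs_sub _ _).trans (le_of_eq ?_)
    rw [abs_of_nonneg h2, abs_of_nonneg h4]
  refine (Finset.sum_le_sum fun a _ => h1 a).trans (le_of_eq ?_)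
  rw [Finset.sum_add_distrib, Finset.sum_comm]
  simp [ZMod.card]
  field_simp
  ring

/-- This lets `k` be replaced by a nearby value on a coarse grid. -/
lemma sum_abs_winSum_dev_le [NeZero M] (r : ℕ → ℕ) (k l B : ℕ) :
    ∑ b, |winSum (dev M r (k + l)) B b| ≤
      ∑ b, |winSum (dev M r k) B b| + 2 * B * l := by
  have h1 : ∀ b, |winSum (dev M r (k + l)) B b| ≤ |winSum (dev M r k) B b| +
      ∑ d ∈ Finset.range B, |dev M r (k + l) (b + d) - dev M r k (b + d)| := by
    intro b
    have h2 := abs_sub_abs_le_abs_sub (winSum (dev M r (k + l)) B b) (winSum (dev M r k) B b)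
    have h3 : |winSum (dev M r (k + l)) B b - winSum (dev M r k) B b| ≤
        ∑ d ∈ Finset.range B, |dev M r (k + l) (b + d) - dev M r k (b + d)| := by
      rw [winSum, winSum, ← Finset.sum_sub_distrib]
      exact Finset.abs_sum_le_sum_abs _ _
    linarith
  refine (Finset.sum_le_sum fun b _ => h1 b).trans ?_
  rw [Finset.sum_add_distrib, Finset.sum_comm]
  simp only [sum_shift (fun b => |dev M r (k + l) b - dev M r k b|)]
  rw [Finset.sum_const, Finset.card_range, nsmul_eq_mul]
  have := mul_le_mul_of_nonneg_left (sum_abs_dev_sub_le (M := M) r k l) (Nat.cast_nonneg B)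
  linarith

end Window

/-! ### Close pairs as correlations of cell counts. -/

section Count

variable {M : ℕ} {N : ℕ} {x : ℕ → ℝ} {w : ℕ → ℕ}

lemma exists_int_of_cast_eq {a b : ℤ} (h : (a : ZMod M) = b) : ∃ m : ℤ, a = b + m * M := by
  obtain ⟨m, hm⟩ := (ZMod.intCast_eq_intCast_iff_dvd_sub b a M).1 h.symm
  exact ⟨m, by linarith⟩

/-- The number of points in a cell. -/
noncomputable def cellCount (M : ℕ) (w : ℕ → ℕ) (N : ℕ) (a : ZMod M) : ℝ :=
  ∑ j ∈ Finset.range N, if (w j : ZMod M) = a then (1 : ℝ) else 0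

open Classical in
/-- The number of pairs, the diagonal included, at distance at most `r`. -/
noncomputable def closePairs (x : ℕ → ℝ) (N : ℕ) (r : ℝ) : ℝ :=
  ∑ i ∈ Finset.range N, ∑ j ∈ Finset.range N,
    if distInt (x i - x j) ≤ r then (1 : ℝ) else 0

lemma sum_winSum_cellCount [NeZero M] (K : ℕ) (t : ZMod M) :
    ∑ a, cellCount M w N a * winSum (cellCount M w N) K (a + t) =
      ∑ i ∈ Finset.range N, ∑ j ∈ Finset.range N, ∑ d ∈ Finset.range K,
        if (w j : ZMod M) = w i + t + d then (1 : ℝ) else 0 := by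
  have h1 : ∀ a : ZMod M, cellCount M w N a * winSum (cellCount M w N) K (a + t) =
      ∑ i ∈ Finset.range N, if (w i : ZMod M) = a then
        winSum (cellCount M w N) K (a + t) else 0 := by
    intro a
    rw [cellCount, Finset.sum_mul]
    exact Finset.sum_congr rfl fun i _ => by split_ifs <;> simp
  simp only [h1]
  rw [Finset.sum_comm]
  refine Finset.sum_congr rfl fun i _ => ?_
  rw [Finset.sum_ite_eq Finset.univ, if_pos (Finset.mem_univ _), winSum, Finset.sum_comm]
  rfl

/-- Points whose cells are at most `L` apart have distance below `(L + 1) / M`. The bound `2 * L + 1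
≤ M` prevents a pair from being counted for two offsets. -/
lemma corr_le_closePairs [NeZero M] (hx : ∀ i < N, (w i : ℝ) / M ≤ x i ∧ x i < ((w i : ℝ) + 1) / M)
    {L : ℕ} {r : ℝ} (hL : (L : ℝ) + 1 ≤ r * M) (hLM : 2 * L + 1 ≤ M) :
    ∑ a, cellCount M w N a * winSum (cellCount M w N) (2 * L + 1) (a + (-L : ℤ)) ≤
      closePairs x N r := by
  have hM : (0 : ℝ) < M := by exact_mod_cast NeZero.pos M
  rw [sum_winSum_cellCount, closePairs]
  refine Finset.sum_le_sum fun i hi => Finset.sum_le_sum fun j hj => ?_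
  rw [← Finset.sum_filter, Finset.sum_const, nsmul_eq_mul, mul_one]
  have hone : ((Finset.range (2 * L + 1)).filter fun d : ℕ =>
      (w j : ZMod M) = w i + (-L : ℤ) + d).card ≤ 1 := by
    rw [Finset.card_le_one]
    intro d hd e he
    simp only [Finset.mem_filter, Finset.mem_range] at hd he
    exact cast_inj_of_lt (by omega) (by omega) (add_left_cancel (hd.2.symm.trans he.2))
  split_ifs with hdist
  · exact_mod_cast hone
  · rw [Finset.card_eq_zero.2, Nat.cast_zero]
    rw [Finset.filter_eq_empty_iff]
    intro d hd h
    apply hdist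
    obtain ⟨m, hm⟩ := exists_int_of_cast_eq (M := M) (a := (w j : ℤ)) (b := w i + (-L) + d)
      (by push_cast; push_cast at h; exact h)
    obtain ⟨hi1, hi2⟩ := hx i (Finset.mem_range.mp hi)
    obtain ⟨hj1, hj2⟩ := hx j (Finset.mem_range.mp hj)
    rw [div_le_iff₀ hM] at hi1 hj1
    rw [lt_div_iff₀ hM] at hi2 hj2
    refine distInt_le_of_int (-m) ?_
    have hmR : (w j : ℝ) = w i + (-L) + d + m * M := by exact_mod_cast hm
    have hdR : (d : ℝ) ≤ 2 * L := by
      have : d ≤ 2 * L := by have := Finset.mem_range.mp hd; omega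
      exact_mod_cast this
    have hd0 : (0 : ℝ) ≤ d := Nat.cast_nonneg d
    rw [abs_le]
    push_cast
    constructor <;> refine le_of_mul_le_mul_right ?_ hM <;> nlinarith

/-- Points at distance at most `r` have a cell offset of at most `r * M + 1`. Repeated counting is
harmless in this direction. -/
lemma closePairs_le_corr [NeZero M] (hx : ∀ i < N, (w i : ℝ) / M ≤ x i ∧ x i < ((w i : ℝ) + 1) / M)
    {L : ℕ} {r : ℝ} (hL : r * M + 1 ≤ L) :
    closePairs x N r ≤
      ∑ a, cellCount M w N a * winSum (cellCount M w N) (2 * L + 1) (a + (-L : ℤ)) := by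
  have hM : (0 : ℝ) < M := by exact_mod_cast NeZero.pos M
  rw [sum_winSum_cellCount, closePairs]
  refine Finset.sum_le_sum fun i hi => Finset.sum_le_sum fun j hj => ?_
  split_ifs with hdist
  · obtain ⟨m, hm⟩ := exists_int_of_distInt_le hdist
    obtain ⟨hi1, hi2⟩ := hx i (Finset.mem_range.mp hi)
    obtain ⟨hj1, hj2⟩ := hx j (Finset.mem_range.mp hj)
    rw [div_le_iff₀ hM] at hi1 hj1
    rw [lt_div_iff₀ hM] at hi2 hj2
    rw [abs_le] at hm
    have hm1 := mul_le_mul_of_nonneg_right hm.1 hM.le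
    have hm2 := mul_le_mul_of_nonneg_right hm.2 hM.le
    have h1 : (0 : ℝ) ≤ ((w j - w i + L + m * M : ℤ) : ℝ) := by
      push_cast
      nlinarith
    have h2 : ((w j - w i + L + m * M : ℤ) : ℝ) ≤ ((2 * L : ℤ) : ℝ) := by
      push_cast
      nlinarith
    have h1' : (0 : ℤ) ≤ w j - w i + L + m * M := by exact_mod_cast h1
    have h2' : (w j - w i + L + m * M : ℤ) ≤ 2 * L := by exact_mod_cast h2
    obtain ⟨d, hd⟩ := Int.eq_ofNat_of_zero_le h1'
    have hdL : d < 2 * L + 1 := by omega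
    have heq : (w j : ZMod M) = w i + (-L : ℤ) + d := by
      have h3 : ((d : ℤ) : ZMod M) = ((w j - w i + L + m * M : ℤ) : ZMod M) := by rw [hd]
      push_cast at h3
      rw [h3]
      simp
      ring
    refine le_trans ?_ (Finset.single_le_sum (f := fun d : ℕ =>
      if (w j : ZMod M) = w i + (-L : ℤ) + d then (1 : ℝ) else 0)
      (fun _ _ => by split_ifs <;> norm_num) (Finset.mem_range.2 hdL))
    simp only [heq, if_true, le_refl]
  · exact Finset.sum_nonneg fun _ _ => by split_ifs <;> norm_num

open Classical in
lemma pairCorr_eq_closePairs {α s : ℝ} (hs : 0 ≤ s) :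
    pairCorr α s x N =
      (closePairs x N (s / (N : ℝ) ^ α) - N) / (N : ℝ) ^ (2 - α) := by
  have hd0 : distInt 0 = 0 := by simp [distInt]
  have h0 : 0 ≤ s / (N : ℝ) ^ α := by positivity
  have hsplit : closePairs x N (s / (N : ℝ) ^ α) =
      (((Finset.range N ×ˢ Finset.range N).filter fun q =>
        q.1 ≠ q.2 ∧ distInt (x q.1 - x q.2) ≤ s / (N : ℝ) ^ α).card : ℝ) + N := by
    have h1 : (N : ℝ) = ∑ i ∈ Finset.range N, ∑ j ∈ Finset.range N,
        if i = j then (1 : ℝ) else 0 := by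
      rw [Finset.sum_congr rfl fun i hi => by rw [Finset.sum_ite_eq, if_pos hi]]
      simp
    rw [Finset.card_filter, Finset.sum_product]
    push_cast
    refine Eq.trans ?_ (congrArg (_ + ·) h1.symm)
    rw [← Finset.sum_add_distrib, closePairs]
    refine Finset.sum_congr rfl fun i _ => ?_
    rw [← Finset.sum_add_distrib]
    refine Finset.sum_congr rfl fun j _ => ?_
    by_cases hij : i = j
    · subst hij
      simp [hd0, h0]
    · simp [hij]
  rw [pairCorr, hsplit]
  ring

end Count

/-! ### Deterministic estimate of the number of close pairs. -/

section Deterministic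

variable {M : ℕ} [NeZero M] {x : ℕ → ℝ} {u : ℕ → ℝ} {ρ r : ℕ → ℕ}

/-- The count is squeezed between two correlations whose windows have `2 * R * M + O(1)` cells. The
rounding and the diagonal cost `O(N)`, within the `11`; the terms with `B` and `D` come from passing
to windows of length `B`. -/
lemma abs_closePairs_sub_le (h : Jittered x M u ρ) (hu : ∀ a, u a ∈ Set.Ico (0 : ℝ) 1)
    {k : ℕ} (hk : k ≤ M) (hr : ∀ j < k, r j < M)
    (hinj : ∀ i < k, ∀ j < k, r i = r j → i = j)
    (hx : ∀ j < k, (r j : ℝ) / M ≤ x (M + j) ∧ x (M + j) < ((r j : ℝ) + 1) / M)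
    {B : ℕ} (hB : 0 < B) {D : ℝ} (hD : ∑ b, |winSum (dev M r k) B b| ≤ D * (B * M))
    {R : ℝ} (hR1 : 1 ≤ R * M) (hR2 : R ≤ 1 / 2) :
    |closePairs x (M + k) R - (M + k : ℕ) - 2 * R * (M + k : ℕ) ^ 2| ≤
      (11 + 4 * B + 10 * D) * (M + k : ℕ) + 4 * R * D * (M + k : ℕ) ^ 2 := by
  have hM : (0 : ℝ) < M := by exact_mod_cast NeZero.pos M
  have hBR : (0 : ℝ) < B := by exact_mod_cast hB
  set N := M + k with hN
  set w : ℕ → ℕ := fun i => if i < M then ρ i else r (i - M) with hw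
  have hwx : ∀ i < N, (w i : ℝ) / M ≤ x i ∧ x i < ((w i : ℝ) + 1) / M := by
    intro i hi
    simp only [hw]
    split_ifs with hiM
    · obtain ⟨h1, h2⟩ := hu (ρ i)
      rw [h.eq i hiM]
      exact ⟨div_le_div_of_nonneg_right (by linarith) hM.le,
        div_lt_div_of_pos_right (by linarith) hM⟩
    · have := hx (i - M) (by omega)
      rwa [show M + (i - M) = i by omega] at this
  have hcount : ∀ a : ZMod M, cellCount M w N a =
      1 + ∑ j ∈ Finset.range k, if (r j : ZMod M) = a then (1 : ℝ) else 0 := by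
    intro a
    rw [cellCount, hN, Finset.sum_range_add]
    congr 1
    · refine Eq.trans ?_ (count_eq_one h.lt h.inj a)
      refine Finset.sum_congr rfl fun j hj => ?_
      simp only [hw, if_pos (Finset.mem_range.mp hj)]
    · refine Finset.sum_congr rfl fun j _ => ?_
      simp [hw]
  have hc : ∀ a : ZMod M, 0 ≤ cellCount M w N a ∧ cellCount M w N a ≤ 2 := by
    intro a
    have h1 := count_le_one hr hinj a
    have h2 := count_nonneg r k a
    rw [hcount]
    constructor <;> linarith
  have hsum : ∑ a, cellCount M w N a = N := by
    simp only [cellCount]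
    rw [Finset.sum_comm]
    simp
  have hdev : ∀ a : ZMod M, dev M r k a = cellCount M w N a - (N : ℝ) / M := by
    intro a
    rw [hcount, dev, hN]
    push_cast
    field_simp
    ring
  have hdev1 := abs_dev_le_one hk hr hinj
  have hG : ∀ K : ℕ, ∑ b, |winSum (dev M r k) K b| ≤ K * M * D + 2 * B * M := by
    intro K
    have h1 := mul_sum_abs_winSum_le hdev1 K B
    have h2 := mul_le_mul_of_nonneg_left hD (Nat.cast_nonneg (α := ℝ) K)
    refine le_of_mul_le_mul_left ?_ hBR
    nlinarith
  have hQ : ∀ (K : ℕ) (t : ZMod M), |∑ a, cellCount M w N a *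
      winSum (cellCount M w N) K (a + t) - K * (N : ℝ) ^ 2 / M| ≤
        2 * (K * M * D + 2 * B * M) := fun K t =>
    (abs_corr_sub_le hc hsum hdev K t).trans (by linarith [hG K])
  have hD0 : 0 ≤ D := by
    have h1 : 0 ≤ ∑ b, |winSum (dev M r k) B b| := Finset.sum_nonneg fun _ _ => abs_nonneg _
    exact nonneg_of_mul_nonneg_left (h1.trans hD) (by positivity)
  have hMN : (M : ℝ) ≤ N := by rw [hN]; push_cast; linarith [Nat.cast_nonneg (α := ℝ) k]
  have hN2 : (N : ℝ) ≤ 2 * M := by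
    have : (k : ℝ) ≤ M := by exact_mod_cast hk
    rw [hN]; push_cast; linarith
  have hy : (N : ℝ) ^ 2 / M ≤ 2 * N := by
    rw [div_le_iff₀ hM]; nlinarith
  have hy0 : 0 ≤ (N : ℝ) ^ 2 / M := by positivity
  have hRy : R * M * ((N : ℝ) ^ 2 / M) = R * N ^ 2 := by field_simp
  set y := (N : ℝ) ^ 2 / M with hydef
  have hR0 : 0 < R := pos_of_mul_pos_left (by linarith) hM.le
  have hMMD : R * D * M ^ 2 ≤ R * D * N ^ 2 :=
    mul_le_mul_of_nonneg_left (pow_le_pow_left₀ hM.le hMN 2) (by positivity)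
  have hMD : D * M ≤ D * N := mul_le_mul_of_nonneg_left hMN hD0
  have hBM : B * (M : ℝ) ≤ B * N := mul_le_mul_of_nonneg_left hMN hBR.le
  have hN0 : (0 : ℝ) ≤ N := Nat.cast_nonneg N
  rw [abs_le]
  constructor
  -- `L` is the integer part of `R * M` minus one; `1 ≤ R * M` makes this a natural number and `R ≤
  -- 1 / 2` keeps the window within one turn.
  · obtain ⟨L, hL⟩ : ∃ L, ⌊R * M⌋₊ = L + 1 :=
      Nat.exists_eq_succ_of_ne_zero (Nat.floor_pos.2 hR1).ne'
    have h1 : (L : ℝ) + 1 ≤ R * M := by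
      have := Nat.floor_le (show 0 ≤ R * M by linarith)
      rw [hL] at this
      exact_mod_cast this
    have h2 : R * M < (L : ℝ) + 2 := by
      have := Nat.lt_floor_add_one (R * M)
      rw [hL] at this
      push_cast at this
      linarith
    have h3 : 2 * L + 1 ≤ M := by
      have : ((2 * L + 1 : ℕ) : ℝ) ≤ M := by push_cast; nlinarith
      exact_mod_cast this
    have h4 := corr_le_closePairs hwx h1 h3
    have h5 := (abs_le.1 (hQ (2 * L + 1) (-L : ℤ))).1
    rw [mul_div_assoc, ← hydef] at h5
    push_cast at h4 h5
    have h6 : (2 * R * M - 3) * y ≤ (2 * L + 1) * y :=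
      mul_le_mul_of_nonneg_right (by linarith) hy0
    have h7 : (2 * (L : ℝ) + 1) * (M * D) ≤ 2 * R * M * (M * D) :=
      mul_le_mul_of_nonneg_right (by linarith) (by positivity)
    have h8 : 0 ≤ D * N := by positivity
    nlinarith
  · have h1 : R * M + 1 ≤ ((⌈R * M⌉₊ + 1 : ℕ) : ℝ) := by
      push_cast
      linarith [Nat.le_ceil (R * M)]
    have h2 : ((⌈R * M⌉₊ + 1 : ℕ) : ℝ) ≤ R * M + 2 := by
      push_cast
      linarith [Nat.ceil_lt_add_one (show 0 ≤ R * M by linarith)]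
    generalize ⌈R * M⌉₊ + 1 = L at h1 h2
    have h4 := closePairs_le_corr hwx h1
    have h5 := (abs_le.1 (hQ (2 * L + 1) (-L : ℤ))).2
    rw [mul_div_assoc, ← hydef] at h5
    push_cast at h4 h5
    have h6 : (2 * (L : ℝ) + 1) * y ≤ (2 * R * M + 5) * y :=
      mul_le_mul_of_nonneg_right (by linarith) hy0
    have h7 : (2 * (L : ℝ) + 1) * (M * D) ≤ (2 * R * M + 5) * (M * D) :=
      mul_le_mul_of_nonneg_right (by linarith) (by positivity)
    nlinarith

end Deterministic

/-! ### Second moments for a uniform permutation. -/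

section Fluctuation

variable {M : ℕ}

/-- The values of a permutation, as a sequence of natural numbers. -/
def permSeq (σ : Equiv.Perm (Fin M)) (j : ℕ) : ℕ := if h : j < M then (σ ⟨j, h⟩ : ℕ) else 0

lemma permSeq_lt (σ : Equiv.Perm (Fin M)) {j : ℕ} (h : j < M) : permSeq σ j < M := by
  rw [permSeq, dif_pos h]
  exact (σ ⟨j, h⟩).2

lemma permSeq_inj (σ : Equiv.Perm (Fin M)) {i j : ℕ} (hi : i < M) (hj : j < M)
    (h : permSeq σ i = permSeq σ j) : i = j := by
  rw [permSeq, permSeq, dif_pos hi, dif_pos hj] at h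
  exact congrArg Fin.val (σ.injective (Fin.ext h))

/-- Cells are residues. -/
def finZMod [NeZero M] : Fin M ≃ ZMod M where
  toFun i := ((i : ℕ) : ZMod M)
  invFun a := ⟨a.val, ZMod.val_lt a⟩
  left_inv i := Fin.ext (ZMod.val_cast_of_lt i.2)
  right_inv a := by simp

/-- Relabelling the cells permutes the deviations; this expresses exchangeability of the cells. -/
lemma dev_mul_perm [NeZero M] (τ : Equiv.Perm (ZMod M)) (σ : Equiv.Perm (Fin M)) {k : ℕ} (hk : k ≤ M)
    (a : ZMod M) : dev M (permSeq (finZMod.symm.permCongr τ * σ)) k (τ a) =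
      dev M (permSeq σ) k a := by
  rw [dev, dev]
  congr 1
  refine Finset.sum_congr rfl fun j hj => ?_
  have hj' : j < M := (Finset.mem_range.mp hj).trans_le hk
  have e1 : (permSeq (finZMod.symm.permCongr τ * σ) j : ZMod M) =
      τ (permSeq σ j : ZMod M) := by
    rw [permSeq, permSeq, dif_pos hj', dif_pos hj']
    simp [finZMod, Equiv.permCongr_apply]
  rw [e1]
  simp only [EmbeddingLike.apply_eq_iff_eq]

lemma sum_dev [NeZero M] (r : ℕ → ℕ) (k : ℕ) : ∑ a, dev M r k a = 0 := by
  have hM : (M : ℝ) ≠ 0 := by exact_mod_cast NeZero.ne M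
  simp only [dev]
  rw [Finset.sum_sub_distrib, Finset.sum_comm]
  simp [ZMod.card]
  field_simp
  ring

/-- Transposing `b` and `c` shows that all mixed moments of `a` with another cell agree. Since the
deviations sum to zero, the mixed moments add up to minus the second moment at `a`. -/
lemma sum_dev_mul_dev_nonpos [NeZero M] {k : ℕ} (hk : k ≤ M) {a b : ZMod M} (hab : a ≠ b) :
    ∑ σ : Equiv.Perm (Fin M), dev M (permSeq σ) k a * dev M (permSeq σ) k b ≤ 0 := by
  have hsymm : ∀ c ∈ Finset.univ.erase a,
      ∑ σ : Equiv.Perm (Fin M), dev M (permSeq σ) k a * dev M (permSeq σ) k c =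
        ∑ σ : Equiv.Perm (Fin M), dev M (permSeq σ) k a * dev M (permSeq σ) k b := by
    intro c hc
    have hca : c ≠ a := Finset.ne_of_mem_erase hc
    rw [← Equiv.sum_comp (Equiv.mulLeft (finZMod.symm.permCongr (Equiv.swap b c)))]
    refine Finset.sum_congr rfl fun σ _ => ?_
    have h1 := dev_mul_perm (Equiv.swap b c) σ hk a
    have h2 := dev_mul_perm (Equiv.swap b c) σ hk b
    rw [Equiv.swap_apply_of_ne_of_ne hab hca.symm] at h1
    rw [Equiv.swap_apply_left] at h2
    rw [Equiv.coe_mulLeft, h1, h2]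
  have hcard : 0 < (Finset.univ.erase a).card := Finset.card_pos.2 ⟨b, by simp [hab.symm]⟩
  have h1 := Finset.sum_congr rfl hsymm
  rw [Finset.sum_const, nsmul_eq_mul, Finset.sum_comm] at h1
  have h2 : ∑ σ : Equiv.Perm (Fin M), ∑ c ∈ Finset.univ.erase a,
      dev M (permSeq σ) k a * dev M (permSeq σ) k c ≤ 0 := by
    refine Finset.sum_nonpos fun σ _ => ?_
    rw [← Finset.mul_sum]
    have := Finset.add_sum_erase Finset.univ (dev M (permSeq σ) k) (Finset.mem_univ a)
    rw [sum_dev] at this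
    rw [eq_neg_of_add_eq_zero_right this]
    nlinarith [sq_nonneg (dev M (permSeq σ) k a)]
  rw [h1] at h2
  have hc' : (0 : ℝ) < ((Finset.univ.erase a).card : ℝ) := by exact_mod_cast hcard
  exact nonpos_of_mul_nonpos_right h2 hc'

/-- Diagonal terms are at most `1` and off-diagonal ones are nonpositive on average; `B ≤ M` makes
the cells of a window distinct. -/
lemma sum_winSum_sq_le [NeZero M] {k B : ℕ} (hk : k ≤ M) (hB : B ≤ M) (b : ZMod M) :
    ∑ σ : Equiv.Perm (Fin M), winSum (dev M (permSeq σ) k) B b ^ 2 ≤ B * M.factorial := by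
  have h1 : ∀ σ : Equiv.Perm (Fin M), winSum (dev M (permSeq σ) k) B b ^ 2 =
      ∑ d ∈ Finset.range B, ∑ e ∈ Finset.range B,
        dev M (permSeq σ) k (b + d) * dev M (permSeq σ) k (b + e) := by
    intro σ
    rw [sq, winSum, Finset.sum_mul_sum]
  simp only [h1]
  rw [Finset.sum_comm]
  have h2 : ∀ d ∈ Finset.range B, ∑ σ : Equiv.Perm (Fin M), ∑ e ∈ Finset.range B,
      dev M (permSeq σ) k (b + d) * dev M (permSeq σ) k (b + e) ≤ M.factorial := by
    intro d hd
    rw [Finset.sum_comm]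
    have h3 : ∀ e ∈ Finset.range B, ∑ σ : Equiv.Perm (Fin M),
        dev M (permSeq σ) k (b + d) * dev M (permSeq σ) k (b + e) ≤
          if d = e then (M.factorial : ℝ) else 0 := by
      intro e he
      split_ifs with hde
      · subst hde
        have : ∀ σ ∈ (Finset.univ : Finset (Equiv.Perm (Fin M))),
            dev M (permSeq σ) k (b + d) * dev M (permSeq σ) k (b + d) ≤ 1 := by
          intro σ _
          have := abs_dev_le_one (r := permSeq σ) hk
            (fun j hj => permSeq_lt σ (hj.trans_le hk))
            (fun i hi j hj => permSeq_inj σ (hi.trans_le hk) (hj.trans_le hk)) (b + d)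
          rw [abs_le] at this
          nlinarith
        refine (Finset.sum_le_card_nsmul _ _ _ this).trans (le_of_eq ?_)
        rw [Finset.card_univ, Fintype.card_perm, Fintype.card_fin]
        simp
      · refine sum_dev_mul_dev_nonpos hk fun h => hde ?_
        have hd' := Finset.mem_range.mp hd
        have he' := Finset.mem_range.mp he
        exact cast_inj_of_lt (by omega) (by omega) (add_left_cancel h)
    refine (Finset.sum_le_sum h3).trans (le_of_eq ?_)
    rw [Finset.sum_ite_eq, if_pos hd]
  refine (Finset.sum_le_card_nsmul _ _ _ h2).trans (le_of_eq ?_)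
  rw [Finset.card_range, nsmul_eq_mul]

/-- The mean square fluctuation of the window counts, summed over the sets of the first `i * q`
values of the permutation, `i < m`. -/
noncomputable def fluct [NeZero M] (m q B : ℕ) (σ : Equiv.Perm (Fin M)) : ℝ :=
  ∑ i ∈ Finset.range m, (∑ b, winSum (dev M (permSeq σ) (min (i * q) M)) B b ^ 2) / (M * B ^ 2)

lemma fluct_nonneg [NeZero M] (m q B : ℕ) (σ : Equiv.Perm (Fin M)) : 0 ≤ fluct m q B σ := by
  unfold fluct
  positivity

lemma sum_fluct_le [NeZero M] {m q B : ℕ} (hB0 : 0 < B) (hB : B ≤ M) :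
    ∑ σ : Equiv.Perm (Fin M), fluct m q B σ ≤ m / B * M.factorial := by
  have hM : (0 : ℝ) < M := by exact_mod_cast NeZero.pos M
  have hBR : (0 : ℝ) < B := by exact_mod_cast hB0
  unfold fluct
  rw [Finset.sum_comm]
  have : ∀ i ∈ Finset.range m, ∑ σ : Equiv.Perm (Fin M),
      (∑ b, winSum (dev M (permSeq σ) (min (i * q) M)) B b ^ 2) / (M * (B : ℝ) ^ 2) ≤
        M.factorial / B := by
    intro i _
    rw [← Finset.sum_div, Finset.sum_comm, div_le_div_iff₀ (by positivity) hBR]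
    have h1 := Finset.sum_le_card_nsmul Finset.univ _ _ fun (b : ZMod M) _ =>
      sum_winSum_sq_le (min_le_right (i * q) M) hB b
    rw [Finset.card_univ, ZMod.card, nsmul_eq_mul] at h1
    refine (mul_le_mul_of_nonneg_right h1 hBR.le).trans (le_of_eq ?_)
    ring
  refine (Finset.sum_le_card_nsmul _ _ _ this).trans (le_of_eq ?_)
  rw [Finset.card_range, nsmul_eq_mul]
  ring

/-- One quantity serves every `k`: Cauchy–Schwarz bounds the window sums at the multiple of `q`
below `k`, and the fewer than `q` further values cost at most `2 * B * q`. -/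
lemma sum_abs_winSum_permSeq_le [NeZero M] {m q B k : ℕ} (hB : 0 < B) (hk : k ≤ M) (hq : 0 < q)
    (hm : M < m * q) (σ : Equiv.Perm (Fin M)) :
    ∑ b, |winSum (dev M (permSeq σ) k) B b| ≤
      (Real.sqrt (fluct m q B σ) + 2 * q / M) * (B * M) := by
  have hM : (0 : ℝ) < M := by exact_mod_cast NeZero.pos M
  have hBR : (0 : ℝ) < B := by exact_mod_cast hB
  set i := k / q with hi
  have him : i < m := (Nat.div_lt_iff_lt_mul hq).2 (hk.trans_lt hm)
  have hik : min (i * q) M = i * q := min_eq_left ((Nat.div_mul_le_self k q).trans hk)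
  have h1 : ∑ b, |winSum (dev M (permSeq σ) (i * q)) B b| ≤
      Real.sqrt (fluct m q B σ) * (B * M) := by
    have h2 := sq_sum_le_card_mul_sum_sq (s := (Finset.univ : Finset (ZMod M)))
      (f := fun b => |winSum (dev M (permSeq σ) (i * q)) B b|)
    simp only [sq_abs, Finset.card_univ, ZMod.card] at h2
    have h3 : (∑ b, winSum (dev M (permSeq σ) (i * q)) B b ^ 2) / (M * (B : ℝ) ^ 2) ≤
        fluct m q B σ := by
      rw [← hik]
      exact Finset.single_le_sum (f := fun i =>
        (∑ b, winSum (dev M (permSeq σ) (min (i * q) M)) B b ^ 2) / (M * (B : ℝ) ^ 2))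
        (fun _ _ => by positivity) (Finset.mem_range.2 him)
    rw [div_le_iff₀ (by positivity)] at h3
    refine abs_le_of_sq_le_sq' ?_ (by positivity) |>.2
    rw [mul_pow, Real.sq_sqrt (fluct_nonneg _ _ _ _)]
    refine h2.trans ?_
    nlinarith [mul_le_mul_of_nonneg_left h3 hM.le]
  have h4 := sum_abs_winSum_dev_le (M := M) (permSeq σ) (i * q) (k % q) B
  rw [show i * q + k % q = k by rw [hi, mul_comm]; exact Nat.div_add_mod k q] at h4
  have h5 : ((k % q : ℕ) : ℝ) ≤ q := by exact_mod_cast (Nat.mod_lt k hq).le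
  have h6 : 2 * (B : ℝ) * (k % q : ℕ) ≤ 2 * B * q :=
    mul_le_mul_of_nonneg_left h5 (by positivity)
  have h7 : 2 * (q : ℝ) / M * (B * M) = 2 * B * q := by field_simp
  linarith

end Fluctuation

/-! ### Almost sure decay of the stage fluctuations. -/

instance (t : ℕ) : NeZero (stageSize t) := ⟨by cases t <;> simp [stageSize]⟩

/-- The fluctuation of stage `n + 1`, with windows of `(n + 1) ^ 3` cells and `n + 1` steps. -/
noncomputable def stageFluct (n : ℕ) (σ : Equiv.Perm (Fin (stageSize (n + 1)))) : ℝ :=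
  fluct (n + 1) (2 ^ (n + 1) / (n + 1) + 1) ((n + 1) ^ 3) σ

/-- The windows of `stageFluct` fit into the circle from `2 ^ 10` cells on. -/
lemma cube_le_two_pow (n : ℕ) : (n + 10) ^ 3 ≤ 2 ^ (n + 10) := by
  induction n with
  | zero => norm_num
  | succ n ih =>
    have e : 2 ^ (n + 1 + 10) = 2 * 2 ^ (n + 10) := by ring
    rw [e]
    have e' : 2 * (n + 10) ^ 3 = (n + 1 + 10) ^ 3 + (n ^ 3 + 27 * n ^ 2 + 237 * n + 669) := by
      ring
    omega

section Prob

variable {Ω : Type*} [MeasurableSpace Ω] {μ : Measure Ω}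
  {perm : (t : ℕ) → Ω → Equiv.Perm (Fin (stageSize t))} {Z : ℕ → Ω → ℝ} {X : ℕ → Ω → ℝ}

lemma lintegral_stageFluct_le (h : IsConstruction μ X perm Z) (n : ℕ)
    (hn : (n + 1) ^ 3 ≤ 2 ^ (n + 1)) :
    ∫⁻ ω, ENNReal.ofReal (stageFluct n (perm (n + 1) ω)) ∂μ ≤
      ENNReal.ofReal (1 / ((n : ℝ) + 1) ^ 2) := by
  have hmap : ∀ σ : Equiv.Perm (Fin (stageSize (n + 1))), (μ.map (perm (n + 1))) {σ} =
      ENNReal.ofReal (((stageSize (n + 1)).factorial : ℝ)⁻¹) := by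
    intro σ
    rw [Measure.map_apply (h.measurable_perm _) MeasurableSpace.measurableSet_top,
      ENNReal.ofReal_inv_of_pos (by positivity), ENNReal.ofReal_natCast]
    exact h.perm_uniform (n + 1) σ
  rw [← lintegral_map (f := fun σ => ENNReal.ofReal (stageFluct n σ))
    (fun _ _ => MeasurableSpace.measurableSet_top) (h.measurable_perm (n + 1)),
    lintegral_fintype]
  simp only [hmap]
  have h0 : ∀ σ ∈ Finset.univ, 0 ≤ stageFluct n σ := fun σ _ => fluct_nonneg _ _ _ _
  rw [← Finset.sum_mul, ← ENNReal.ofReal_sum_of_nonneg h0,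
    ← ENNReal.ofReal_mul (Finset.sum_nonneg h0)]
  refine ENNReal.ofReal_le_ofReal ?_
  -- The cube is chosen so that `m / B = 1 / (n + 1) ^ 2` is summable.
  have h1 := sum_fluct_le (M := stageSize (n + 1)) (m := n + 1)
    (q := 2 ^ (n + 1) / (n + 1) + 1) (B := (n + 1) ^ 3) (by positivity) hn
  refine (mul_le_mul_of_nonneg_right h1 (by positivity)).trans (le_of_eq ?_)
  have : ((stageSize (n + 1)).factorial : ℝ) ≠ 0 := by positivity
  push_cast
  field_simp

/-- The expectations are summable, so the series converges almost surely and its terms tend to zero.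
-/
lemma ae_tendsto_stageFluct (h : IsConstruction μ X perm Z) :
    ∀ᵐ ω ∂μ, Tendsto (fun n => stageFluct n (perm (n + 1) ω)) atTop (𝓝 0) := by
  have hsum : ∑' n : ℕ, ∫⁻ ω, ENNReal.ofReal (stageFluct (n + 9) (perm (n + 9 + 1) ω)) ∂μ ≠
      ⊤ := by
    have h1 : Summable fun n : ℕ => 1 / (((n + 9 : ℕ) : ℝ) + 1) ^ 2 := by
      have := (summable_nat_add_iff 10).2 (Real.summable_one_div_nat_pow.2 one_lt_two)
      refine this.congr fun n => ?_
      push_cast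
      ring
    refine ne_top_of_le_ne_top h1.tsum_ofReal_ne_top (ENNReal.tsum_le_tsum fun n => ?_)
    exact lintegral_stageFluct_le h (n + 9) (cube_le_two_pow n)
  have hmeas : ∀ n, Measurable fun ω =>
      ENNReal.ofReal (stageFluct (n + 9) (perm (n + 9 + 1) ω)) := fun n =>
    (show Measurable fun σ => ENNReal.ofReal (stageFluct (n + 9) σ) from
      fun _ _ => MeasurableSpace.measurableSet_top).comp (h.measurable_perm _)
  rw [← lintegral_tsum fun n => (hmeas n).aemeasurable] at hsum
  filter_upwards [ae_lt_top (Measurable.tsum hmeas) hsum] with ω hω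
  have h2 := ENNReal.tendsto_atTop_zero_of_tsum_ne_top hω.ne
  have h3 := (ENNReal.tendsto_toReal ENNReal.zero_ne_top).comp h2
  simp only [ENNReal.toReal_zero] at h3
  refine (tendsto_add_atTop_iff_nat 9).1 (h3.congr fun n => ?_)
  exact ENNReal.toReal_ofReal (fluct_nonneg _ _ _ _)

end Prob

/-! ### Passage to the limit for `α < 1`. -/

section Limit

variable {p : (t : ℕ) → Equiv.Perm (Fin (stageSize t))} {z : ℕ → ℝ} {x : ℕ → ℝ}

/-- The bound for the relative window fluctuation at stage `n + 1`. -/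
noncomputable def stageError (p : (t : ℕ) → Equiv.Perm (Fin (stageSize t))) (n : ℕ) : ℝ :=
  Real.sqrt (stageFluct n (p (n + 1))) + 2 * (1 / ((n : ℝ) + 1) + (1 / 2) ^ (n + 1))

lemma tendsto_stageError (h : Tendsto (fun n => stageFluct n (p (n + 1))) atTop (𝓝 0)) :
    Tendsto (stageError p) atTop (𝓝 0) := by
  have h1 := (Real.continuous_sqrt.tendsto 0).comp h
  rw [Real.sqrt_zero] at h1
  have h2 : Tendsto (fun n : ℕ => ((1 : ℝ) / 2) ^ (n + 1)) atTop (𝓝 0) :=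
    (tendsto_pow_atTop_nhds_zero_of_lt_one (by norm_num) (by norm_num)).comp
      (tendsto_add_atTop_nat 1)
  have h3 := h1.add (((tendsto_one_div_add_atTop_nhds_zero_nat (𝕜 := ℝ)).add h2).const_mul 2)
  rw [add_zero, mul_zero, add_zero] at h3
  exact h3

lemma Built.abs_closePairs_sub_le (h : Built x p z) (n : ℕ) {k : ℕ} (hk : k ≤ 2 ^ (n + 1))
    {R : ℝ} (hR1 : 1 ≤ R * 2 ^ (n + 1)) (hR2 : R ≤ 1 / 2) :
    |closePairs x (2 ^ (n + 1) + k) R - (2 ^ (n + 1) + k : ℕ) -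
        2 * R * (2 ^ (n + 1) + k : ℕ) ^ 2| ≤
      (11 + 4 * ((n : ℝ) + 1) ^ 3 + 10 * stageError p n) * (2 ^ (n + 1) + k : ℕ) +
        4 * R * stageError p n * (2 ^ (n + 1) + k : ℕ) ^ 2 := by
  obtain ⟨ρ, hρ⟩ := h.jittered n
  have hM : (0 : ℝ) < 2 ^ (n + 1) := by positivity
  have hx : ∀ j < k, (rankAt p (n + 1) j : ℝ) / (stageSize (n + 1) : ℕ) ≤
      x (stageSize (n + 1) + j) ∧
      x (stageSize (n + 1) + j) < ((rankAt p (n + 1) j : ℝ) + 1) / (stageSize (n + 1) : ℕ) := by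
    intro j hj
    have e : stageSize (n + 1) = 2 ^ (n + 1) := rfl
    rw [e, h.step_eq hρ (hj.trans_le hk)]
    obtain ⟨h1, h2⟩ := h.pos (2 ^ (n + 1) + j)
    push_cast
    rw [div_le_div_iff₀ hM (by positivity), div_lt_div_iff₀ (by positivity) hM]
    constructor <;> split_ifs <;> nlinarith
  -- Rounding `M / (n + 1)` up past its integer part gives `M < (n + 1) * q`, while `2 * q / M`
  -- still tends to zero.
  have hD := sum_abs_winSum_permSeq_le (M := stageSize (n + 1)) (m := n + 1)
    (q := 2 ^ (n + 1) / (n + 1) + 1) (B := (n + 1) ^ 3) (k := k) (by positivity) hk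
    (by positivity) (by
      have := Nat.lt_mul_div_succ (2 ^ (n + 1)) (show 0 < n + 1 by omega)
      exact this) (p (n + 1))
  have hq : Real.sqrt (fluct (n + 1) (2 ^ (n + 1) / (n + 1) + 1) ((n + 1) ^ 3) (p (n + 1))) +
      2 * ((2 ^ (n + 1) / (n + 1) + 1 : ℕ) : ℝ) / (stageSize (n + 1) : ℕ) ≤ stageError p n := by
    have h1 : ((2 ^ (n + 1) / (n + 1) : ℕ) : ℝ) ≤ 2 ^ (n + 1) / ((n : ℝ) + 1) := by
      refine Nat.cast_div_le.trans (le_of_eq ?_)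
      push_cast
      rfl
    have e : ((stageSize (n + 1) : ℕ) : ℝ) = 2 ^ (n + 1) := by simp [stageSize]
    rw [stageError, stageFluct, e]
    refine add_le_add le_rfl ?_
    rw [div_le_iff₀ hM]
    have e2 : ((1 : ℝ) / 2) ^ (n + 1) * 2 ^ (n + 1) = 1 := by
      rw [← mul_pow]
      norm_num
    push_cast
    calc (2 : ℝ) * (((2 ^ (n + 1) / (n + 1) : ℕ) : ℝ) + 1)
        ≤ 2 * (2 ^ (n + 1) / ((n : ℝ) + 1) + 1) := by linarith
      _ = 2 * (1 / ((n : ℝ) + 1) * 2 ^ (n + 1) + (1 / 2) ^ (n + 1) * 2 ^ (n + 1)) := by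
        rw [e2]; ring
      _ = _ := by ring
  have hD' := hD.trans (mul_le_mul_of_nonneg_right hq (by positivity))
  -- `rankAt p (n + 1)` and `permSeq (p (n + 1))` agree by unfolding, so `hD'` fits.
  have := SeqJitter.abs_closePairs_sub_le (M := stageSize (n + 1)) (r := rankAt p (n + 1)) hρ
    (cellPos_mem h.pos n) hk (fun j hj => rankAt_lt (lt_of_lt_of_le hj hk))
    (fun i hi j hj => rankAt_inj (lt_of_lt_of_le hi hk) (lt_of_lt_of_le hj hk)) hx
    (B := (n + 1) ^ 3) (by positivity) hD' (by simpa [stageSize] using hR1) hR2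
  push_cast at this ⊢
  simpa [stageSize] using this

/-- After division by `N ^ (2 - α)` the linear error is a cubic polynomial in `n`, up to a bounded
term, times `N ^ (α - 1)`, which decays geometrically in `n`; the quadratic error becomes a multiple
of `stageError`. -/
lemma Built.hasPPC (h : Built x p z)
    (hfl : Tendsto (fun n => stageFluct n (p (n + 1))) atTop (𝓝 0)) {α : ℝ} (hα0 : 0 < α)
    (hα1 : α < 1) : HasPPC α x := by
  intro s hs
  set c : ℝ := 2 ^ (α - 1) with hc
  have hc0 : 0 < c := by positivity
  have hc1 : c < 1 := Real.rpow_lt_one_of_one_lt_of_neg one_lt_two (by linarith)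
  set bd : ℕ → ℝ := fun n =>
    (11 + 4 * ((n : ℝ) + 1) ^ 3 + 10 * stageError p n) * c ^ (n + 1) +
      4 * s * stageError p n with hbd
  have hbd0 : Tendsto bd atTop (𝓝 0) := by
    have hE := tendsto_stageError hfl
    have h1 : Tendsto (fun n : ℕ => c ^ (n + 1)) atTop (𝓝 0) :=
      (tendsto_pow_atTop_nhds_zero_of_lt_one hc0.le hc1).comp (tendsto_add_atTop_nat 1)
    have h2 : Tendsto (fun n : ℕ => ((n : ℝ) + 1) ^ 3 * c ^ (n + 1)) atTop (𝓝 0) := by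
      have := (tendsto_pow_const_mul_const_pow_of_abs_lt_one 3
        (show |c| < 1 by rwa [abs_of_pos hc0])).comp (tendsto_add_atTop_nat 1)
      refine this.congr fun n => ?_
      simp
    have h3 := (((h1.const_mul 11).add (h2.const_mul 4)).add ((hE.const_mul 10).mul h1)).add
      (hE.const_mul (4 * s))
    simp only [mul_zero, add_zero] at h3
    refine h3.congr fun n => ?_
    simp only [hbd]
    ring
  have hlog : Tendsto (fun N : ℕ => Nat.log 2 N - 1) atTop atTop :=
    (tendsto_sub_atTop_nat 1).comp (tendsto_atTop_atTop.2 fun b => ⟨2 ^ b, fun N hN =>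
      Nat.le_log_of_pow_le one_lt_two hN⟩)
  -- These two conditions make the radius `s / N ^ α` at most `1 / 2` and at least one cell wide;
  -- the second uses that `N` is at most twice the number of cells.
  have hev1 : ∀ᶠ N : ℕ in atTop, 2 * s ≤ (N : ℝ) ^ α :=
    ((tendsto_rpow_atTop hα0).comp tendsto_natCast_atTop_atTop).eventually_ge_atTop _
  have hev2 : ∀ᶠ N : ℕ in atTop, 2 / s ≤ (N : ℝ) ^ (1 - α) :=
    ((tendsto_rpow_atTop (by linarith : 0 < 1 - α)).comp
      tendsto_natCast_atTop_atTop).eventually_ge_atTop _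
  rw [tendsto_iff_dist_tendsto_zero]
  refine squeeze_zero' (Eventually.of_forall fun _ => dist_nonneg) ?_ (hbd0.comp hlog)
  filter_upwards [hev1, hev2, eventually_ge_atTop 2] with N h1 h2 hN
  obtain ⟨n, hn⟩ : ∃ n, Nat.log 2 N = n + 1 :=
    Nat.exists_eq_succ_of_ne_zero (Nat.log_pos one_lt_two hN).ne'
  have hMN : 2 ^ (n + 1) ≤ N := by
    rw [← hn]
    exact Nat.pow_log_le_self 2 (by omega)
  have hNM : N < 2 ^ (n + 1) * 2 := by
    have := Nat.lt_pow_succ_log_self one_lt_two N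
    rw [hn] at this
    rwa [Nat.succ_eq_add_one, pow_succ] at this
  obtain ⟨k, rfl⟩ := Nat.exists_eq_add_of_le hMN
  simp only [Function.comp, hn, Nat.add_sub_cancel]
  rw [Real.dist_eq, pairCorr_eq_closePairs hs.le]
  have hMN' : (2 : ℝ) ^ (n + 1) ≤ ((2 ^ (n + 1) + k : ℕ) : ℝ) := by exact_mod_cast hMN
  have hNM' : ((2 ^ (n + 1) + k : ℕ) : ℝ) ≤ 2 ^ (n + 1) * 2 := by exact_mod_cast hNM.le
  have hmain := fun R => h.abs_closePairs_sub_le n (k := k) (R := R) (by omega)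
  generalize 2 ^ (n + 1) + k = N at *
  have hNpos : (0 : ℝ) < N := by
    have : 0 < N := by omega
    exact_mod_cast this
  have hNα : (0 : ℝ) < (N : ℝ) ^ α := by positivity
  have e1 : (N : ℝ) ^ (1 - α) * (N : ℝ) ^ α = N := by
    rw [← Real.rpow_add hNpos]
    simp
  have hR1 : 1 ≤ s / (N : ℝ) ^ α * 2 ^ (n + 1) := by
    rw [div_mul_eq_mul_div, le_div_iff₀ hNα, one_mul]
    rw [div_le_iff₀ hs] at h2
    nlinarith [mul_le_mul_of_nonneg_right h2 hNα.le]
  have hR2 : s / (N : ℝ) ^ α ≤ 1 / 2 := by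
    rw [div_le_div_iff₀ hNα (by norm_num)]
    linarith
  have hm := hmain _ hR1 hR2
  have hW : (0 : ℝ) < (N : ℝ) ^ (2 - α) := by positivity
  have e2 : (N : ℝ) ^ (2 - α) * (N : ℝ) ^ α = (N : ℝ) ^ 2 := by
    rw [← Real.rpow_add hNpos, sub_add_cancel]
    norm_num
  have e3 : s / (N : ℝ) ^ α * (N : ℝ) ^ 2 = s * (N : ℝ) ^ (2 - α) := by
    rw [← e2]
    field_simp
  have e4 : (N : ℝ) = (N : ℝ) ^ (α - 1) * (N : ℝ) ^ (2 - α) := by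
    rw [← Real.rpow_add hNpos]
    ring_nf
    simp
  have hE0 : 0 ≤ stageError p n := by
    unfold stageError
    positivity
  have h5 : (N : ℝ) ^ (α - 1) ≤ c ^ (n + 1) := by
    refine (Real.rpow_le_rpow_of_nonpos (by positivity) hMN' (by linarith)).trans (le_of_eq ?_)
    rw [hc, ← Real.rpow_natCast, ← Real.rpow_natCast, ← Real.rpow_mul (by norm_num),
      ← Real.rpow_mul (by norm_num), mul_comm]
  have h6 : (closePairs x N (s / (N : ℝ) ^ α) - N) / (N : ℝ) ^ (2 - α) - 2 * s =
      (closePairs x N (s / (N : ℝ) ^ α) - N - 2 * (s / (N : ℝ) ^ α) * (N : ℝ) ^ 2) /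
        (N : ℝ) ^ (2 - α) := by
    rw [mul_assoc 2, e3]
    field_simp
  rw [h6, abs_div, abs_of_pos hW, div_le_iff₀ hW]
  refine hm.trans ?_
  have h7 : 4 * (s / (N : ℝ) ^ α) * stageError p n * (N : ℝ) ^ 2 =
      4 * s * stageError p n * (N : ℝ) ^ (2 - α) := by
    linear_combination (4 * stageError p n) * e3
  rw [h7]
  simp only [hbd, add_mul _ (4 * s * stageError p n)]
  refine add_le_add ?_ le_rfl
  rw [mul_assoc]
  refine mul_le_mul_of_nonneg_left ?_ (by positivity)
  calc (N : ℝ) = (N : ℝ) ^ (α - 1) * (N : ℝ) ^ (2 - α) := e4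
    _ ≤ _ := mul_le_mul_of_nonneg_right h5 hW.le

end Limit

end SeqJitter

theorem theorem2 {Ω : Type*} [MeasurableSpace Ω] (μ : Measure Ω) [IsProbabilityMeasure μ]
    (X : ℕ → Ω → ℝ) (hX : SeqJitter.IsSequentialJitteredSampling μ X) :
    ((∀ᵐ ω ∂μ, ¬ SeqJitter.HasPPC 1 (fun i => X i ω)) ∧
      Tendsto (fun n : ℕ => ∫ ω, SeqJitter.pairCorr 1 (1 / 2) (fun i => X i ω) (2 ^ n) ∂μ)
        atTop (𝓝 (1 / 4))) ∧
    (∀ᵐ ω ∂μ, ∀ α : ℝ, 0 < α → α < 1 → SeqJitter.HasPPC α (fun i => X i ω)) := by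
  obtain ⟨perm, Z, h⟩ := hX
  refine ⟨⟨?_, ?_⟩, ?_⟩
  · filter_upwards [SeqJitter.ae_built h] with ω hω using hω.not_hasPPC_one
  · refine tendsto_const_nhds.congr' ?_
    filter_upwards [eventually_ge_atTop 2] with n hn
    obtain ⟨m, rfl⟩ := Nat.exists_eq_add_of_le' (show 1 ≤ n by omega)
    exact (SeqJitter.integral_pairCorr h (by omega)).symm
  · filter_upwards [SeqJitter.ae_built h, SeqJitter.ae_tendsto_stageFluct h] with ω hω hfl
    exact fun α hα0 hα1 => hω.hasPPC hfl hα0 hα1
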